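/- Let $m,n\ge 1$, let $Q=(q_{ijk\ell})$ be a real $m\times m\times n\times n$ array, and let $C=(c_{ij})$ and $D=(d_{k\ell})$ be real $m\times m$ and $n\times n$ matrices. The bilinear assignment problem (BAP) with data $(Q,C,D)$ is to minimize $$f(\mathbf x,\mathbf y)=\sum_{i,j=1}^m\sum_{k,\ell=1}^n q_{ijk\ell}x_{ij}y_{k\ell}+\sum_{i,j=1}^m c_{ij}x_{ij}+\sum_{k,\ell=1}^n d_{k\ell}y_{k\ell}$$ over all assignment matrices $\mathbf x\in\{0,1\}^{m\times m}$ and $\mathbf y\in\{0,1\}^{n\times n}$, that is, 0-1 matrices all of whose row sums and column sums are $1$. A matrix is a sum matrix if its $(i,j)$ entry is $r_i+s_j$ for some vectors $r,s$. Write $A\cdot \mathbf z=\sum_{i,j}A_{ij}z_{ij}$; the linear assignment problem (LAP) with cost matrix $A$ is to minimize $A\cdot\mathbf z$ over all assignment matrices $\mathbf z$. **Theorem.** There is an algorithm (a single program for a unit-cost real RAM with operations $+,-,\times$ and comparisons on real numbers) which, given $m$, $n$, an $m\times m$ matrix $a$, an $n\times n$ matrix $b$, and $C$, $D$ such that $C$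 or $D$ is a sum matrix, computes in $O(m^3+n^3)$ time an optimal solution $(\mathbf x,\mathbf y)$ of the BAP with data $(Q,C,D)$, where $q_{ijk\ell}=a_{ij}b_{k\ell}$. Moreover, for every such $Q$: if $D$ is a sum matrix, $\mathbf y_1$ minimizes and $\mathbf y_2$ maximizes $b\cdot\mathbf y$ over the assignment matrices, and $\mathbf x_p$ is an optimal solution of the LAP with cost matrix $(b\cdot\mathbf y_p)\,a+C$ for $p=1,2$, then whichever of $(\mathbf x_1,\mathbf y_1)$, $(\mathbf x_2,\mathbf y_2)$ has the smaller value of $f$ (either one in case of a tie) is an optimal solution of the BAP. Symmetrically, if $C$ is a sum matrix, $\mathbf x_1$ minimizes and $\mathbf x_2$ maximizes $a\cdot\mathbf x$ over the assignment matrices, and $\mathbf y_p$ is an optimal solution of the LAP with cost matrix $(a\cdot\mathbf x_p)\,b+D$ for $p=1,2$, then the better of $(\mathbf x_1,\mathbf y_1)$, $(\mathbf x_2,\mathbf y_2)$ is an optimal solution of the BAP. -/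

import Mathlib

namespace BAP

/-! ### The bilinear assignment problem -/

/-- 0-1 matrices all of whose row sums and column sums are `1`. -/
def IsAssignment {m : ℕ} (x : Matrix (Fin m) (Fin m) ℝ) : Prop :=
  (∀ i j, x i j = 0 ∨ x i j = 1) ∧ (∀ i, ∑ j, x i j = 1) ∧ (∀ j, ∑ i, x i j = 1)

/-- The linear cost `∑ a_ij x_ij`. -/
def linCost {m : ℕ} (a x : Matrix (Fin m) (Fin m) ℝ) : ℝ :=
  ∑ i, ∑ j, a i j * x i j

/-- The objective function of the bilinear assignment problem with cost arrays `Q`, `C`, `D`. -/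
def objective {m n : ℕ} (Q : Fin m → Fin m → Fin n → Fin n → ℝ)
    (C : Matrix (Fin m) (Fin m) ℝ) (D : Matrix (Fin n) (Fin n) ℝ)
    (x : Matrix (Fin m) (Fin m) ℝ) (y : Matrix (Fin n) (Fin n) ℝ) : ℝ :=
  (∑ i, ∑ j, ∑ k, ∑ l, Q i j k l * x i j * y k l) + (∑ i, ∑ j, C i j * x i j) +
    ∑ k, ∑ l, D k l * y k l

/-- `(x, y)` is an optimal solution of the instance `(Q, C, D)`. -/
def IsOptimal {m n : ℕ} (Q : Fin m → Fin m → Fin n → Fin n → ℝ)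
    (C : Matrix (Fin m) (Fin m) ℝ) (D : Matrix (Fin n) (Fin n) ℝ)
    (x : Matrix (Fin m) (Fin m) ℝ) (y : Matrix (Fin n) (Fin n) ℝ) : Prop :=
  IsAssignment x ∧ IsAssignment y ∧
    ∀ x' y', IsAssignment x' → IsAssignment y' → objective Q C D x y ≤ objective Q C D x' y'

/-- `x` is an optimal solution of the linear assignment problem with cost matrix `a`. -/
def IsLAPMin {m : ℕ} (a x : Matrix (Fin m) (Fin m) ℝ) : Prop :=
  IsAssignment x ∧ ∀ x', IsAssignment x' → linCost a x ≤ linCost a x'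

/-- `x` is an assignment of maximum cost for the cost matrix `a`. -/
def IsLAPMax {m : ℕ} (a x : Matrix (Fin m) (Fin m) ℝ) : Prop :=
  IsAssignment x ∧ ∀ x', IsAssignment x' → linCost a x' ≤ linCost a x

/-- Matrices of the form `r_i + s_j`. -/
def IsSumMatrix {m : ℕ} (A : Matrix (Fin m) (Fin m) ℝ) : Prop :=
  ∃ r s : Fin m → ℝ, ∀ i j, A i j = r i + s j

/-- `a`, `b` is a factored form of the array `Q` (with a single term). -/
def IsFactoredForm {m n : ℕ} (Q : Fin m → Fin m → Fin n → Fin n → ℝ)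
    (a : Matrix (Fin m) (Fin m) ℝ) (b : Matrix (Fin n) (Fin n) ℝ) : Prop :=
  ∀ i j k l, Q i j k l = a i j * b k l

/-! ### A real RAM

The memory consists of two-dimensional arrays `0, 1, 2, …` of natural numbers (used for indices)
and of two-dimensional arrays `0, 1, 2, …` of real numbers; array cells are addressed indirectly.
Scalar variables are cells `[0][0]`. Programs are finite texts that cannot depend on the input.
Every operation costs one unit of time. Natural numbers can only be incremented, decremented and
compared, so after `t` steps they exceed the input sizes and the program's constants by at
most `t`. Real numbers can only be added, subtracted, multiplied and compared, so that for integer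
data all computed numbers are integers; there is no rounding and no conversion between the two
kinds of numbers. -/

/-- A memory state: `ints k i j` and `reals k i j` are the cells `[i][j]` of the `k`-th arrays. -/
structure State where
  ints : ℕ → ℕ → ℕ → ℕ
  reals : ℕ → ℕ → ℕ → ℝ

/-- Index expressions. -/
inductive IExp where
  | const (c : ℕ)
  | succ (e : IExp)
  | pred (e : IExp)
  | get (k : ℕ) (i j : IExp)

def IExp.eval (s : State) : IExp → ℕ
  | .const c => c
  | .succ e => e.eval s + 1
  | .pred e => e.eval s - 1
  | .get k i j => s.ints k (i.eval s) (j.eval s)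

/-- The number of operations in an index expression. -/
def IExp.cost : IExp → ℕ
  | .const _ => 1
  | .succ e => e.cost + 1
  | .pred e => e.cost + 1
  | .get _ i j => i.cost + j.cost + 1

/-- Real expressions. -/
inductive RExp where
  | zero
  | one
  | get (k : ℕ) (i j : IExp)
  | add (e f : RExp)
  | sub (e f : RExp)
  | mul (e f : RExp)

noncomputable def RExp.eval (s : State) : RExp → ℝ
  | .zero => 0
  | .one => 1
  | .get k i j => s.reals k (i.eval s) (j.eval s)
  | .add e f => e.eval s + f.eval s
  | .sub e f => e.eval s - f.eval s
  | .mul e f => e.eval s * f.eval s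

/-- The number of operations in a real expression. -/
def RExp.cost : RExp → ℕ
  | .zero => 1
  | .one => 1
  | .get _ i j => i.cost + j.cost + 1
  | .add e f => e.cost + f.cost + 1
  | .sub e f => e.cost + f.cost + 1
  | .mul e f => e.cost + f.cost + 1

/-- Tests. -/
inductive BExp where
  | ieq (e f : IExp)
  | ilt (e f : IExp)
  | req (e f : RExp)
  | rlt (e f : RExp)
  | neg (p : BExp)
  | conj (p q : BExp)

def BExp.Holds (s : State) : BExp → Prop
  | .ieq e f => e.eval s = f.eval s
  | .ilt e f => e.eval s < f.eval s
  | .req e f => e.eval s = f.eval s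
  | .rlt e f => e.eval s < f.eval s
  | .neg p => ¬ p.Holds s
  | .conj p q => p.Holds s ∧ q.Holds s

/-- The number of operations in a test. -/
def BExp.cost : BExp → ℕ
  | .ieq e f => e.cost + f.cost + 1
  | .ilt e f => e.cost + f.cost + 1
  | .req e f => e.cost + f.cost + 1
  | .rlt e f => e.cost + f.cost + 1
  | .neg p => p.cost + 1
  | .conj p q => p.cost + q.cost + 1

/-- Programs: assignments to a cell of an index array or of a real array, composition,
branching, loops. -/
inductive Prog where
  | skip
  | iset (k : ℕ) (i j e : IExp)
  | rset (k : ℕ) (i j : IExp) (e : RExp)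
  | seq (p q : Prog)
  | ite (c : BExp) (p q : Prog)
  | while (c : BExp) (p : Prog)

/-- Overwrite the cell `[i][j]` of the `k`-th array by `v`. -/
def setCell {α : Type} (f : ℕ → ℕ → ℕ → α) (k i j : ℕ) (v : α) : ℕ → ℕ → ℕ → α :=
  fun k' i' j' => if k' = k ∧ i' = i ∧ j' = j then v else f k' i' j'

/-- `Run p s t s'`: started in state `s`, the program `p` halts after exactly `t` steps,
in state `s'`. -/
inductive Run : Prog → State → ℕ → State → Prop
  | skip (s : State) : Run .skip s 1 s
  | iset (s : State) (k : ℕ) (i j e : IExp) :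
      Run (.iset k i j e) s (i.cost + j.cost + e.cost + 1)
        { s with ints := setCell s.ints k (i.eval s) (j.eval s) (e.eval s) }
  | rset (s : State) (k : ℕ) (i j : IExp) (e : RExp) :
      Run (.rset k i j e) s (i.cost + j.cost + e.cost + 1)
        { s with reals := setCell s.reals k (i.eval s) (j.eval s) (e.eval s) }
  | seq {p q : Prog} {s s₁ s₂ : State} {t₁ t₂ : ℕ} :
      Run p s t₁ s₁ → Run q s₁ t₂ s₂ → Run (.seq p q) s (t₁ + t₂) s₂
  | ite_true {c : BExp} {p q : Prog} {s s₁ : State} {t : ℕ} :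
      c.Holds s → Run p s t s₁ → Run (.ite c p q) s (c.cost + t + 1) s₁
  | ite_false {c : BExp} {p q : Prog} {s s₁ : State} {t : ℕ} :
      ¬ c.Holds s → Run q s t s₁ → Run (.ite c p q) s (c.cost + t + 1) s₁
  | while_false {c : BExp} {p : Prog} {s : State} :
      ¬ c.Holds s → Run (.while c p) s (c.cost + 1) s
  | while_true {c : BExp} {p : Prog} {s s₁ s₂ : State} {t₁ t₂ : ℕ} :
      c.Holds s → Run p s t₁ s₁ → Run (.while c p) s₁ t₂ s₂ →
        Run (.while c p) s (c.cost + t₁ + t₂ + 1) s₂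

/-- A matrix as the contents of an array; cells outside its range are `0`. -/
def padded {m : ℕ} (A : Matrix (Fin m) (Fin m) ℝ) (i j : ℕ) : ℝ :=
  if h : i < m ∧ j < m then A ⟨i, h.1⟩ ⟨j, h.2⟩ else 0

/-- The input: the sizes `m`, `n` are the cells `[0][0]` of index arrays `0` and `1`, the matrices
`a, b, C, D` (with rows and columns counted from `0`) are in real arrays `0, 1, 2, 3`, and all
other cells are `0`. -/
def inputState {m n : ℕ} (a : Matrix (Fin m) (Fin m) ℝ) (b : Matrix (Fin n) (Fin n) ℝ)
    (C : Matrix (Fin m) (Fin m) ℝ) (D : Matrix (Fin n) (Fin n) ℝ) : State where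
  ints k i j :=
    if k = 0 ∧ i = 0 ∧ j = 0 then m else if k = 1 ∧ i = 0 ∧ j = 0 then n else 0
  reals k i j :=
    if k = 0 then padded a i j else if k = 1 then padded b i j
    else if k = 2 then padded C i j else if k = 3 then padded D i j else 0

/-- The leading `m × m` block of the `k`-th real array. -/
def State.matrix (s : State) (k m : ℕ) : Matrix (Fin m) (Fin m) ℝ :=
  fun i j => s.reals k i j

end BAP

/-! For a factored array the objective is `(a·x)(b·y) + C·x + D·y`. If `D` is a sum matrix, `D·y` is
the same for all assignments `y`, so for fixed `x` the objective is affine in the single number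
`b·y`, and it is least where `b·y` is extreme: at a minimizer `y₁` if `a·x ≥ 0`, at a maximizer `y₂`
otherwise. Once `y_p` is fixed, the best `x` solves the LAP with costs `(b·y_p) a + C`. This is
`productCost_le_or_le`; the other case follows by exchanging the two roles (`productCost_swap`).

The algorithmic half rests on a verified cubic solver for the LAP, `lap_spec`: the Hungarian method
in its shortest augmenting path form. Rows are inserted one at a time, each with a Dijkstra-like
search for a free column in quadratic time. Only a column potential `v` is stored; the potential of
a matched row is read off from its own edge as `c (p k) k - v k`, so matched edges are tight by
definition and `slack` is the reduced cost. `Search.step` changes the potential while keeping all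
slacks of matched rows nonnegative, `Augment.step` moves rows along edges of slack zero, and
`Tight.isLAPMin` is weak duality for the final perfect matching.

`solver` does not test which of `C` and `D` is a sum matrix. It computes the two candidates for each
alternative and keeps the best of the four: all are feasible, and under either hypothesis two of
them already include an optimum.

Running times come from a Hoare-style logic. `Reaches` combines termination, a step bound and a
postcondition; `Frame`, read off from the syntax, transports everything that a subprogram does not
write. The numerical constants are generous, and sizes of at least `1` let them absorb lower-order
terms. -/

namespace BAP

/-! ### A program logic with time bounds -/

/-- The index arrays that a program may write. -/
def Prog.intWrites : Prog → List ℕ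
  | .skip => []
  | .iset k _ _ _ => [k]
  | .rset _ _ _ _ => []
  | .seq p q => p.intWrites ++ q.intWrites
  | .ite _ p q => p.intWrites ++ q.intWrites
  | .while _ p => p.intWrites

/-- The real arrays that a program may write. -/
def Prog.realWrites : Prog → List ℕ
  | .skip => []
  | .iset _ _ _ _ => []
  | .rset k _ _ _ => [k]
  | .seq p q => p.realWrites ++ q.realWrites
  | .ite _ p q => p.realWrites ++ q.realWrites
  | .while _ p => p.realWrites

/-- The states `s` and `s'` agree on all arrays that `p` does not write. -/
def Frame (p : Prog) (s s' : State) : Prop :=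
  (∀ k, k ∉ p.intWrites → s'.ints k = s.ints k) ∧
    ∀ k, k ∉ p.realWrites → s'.reals k = s.reals k

theorem Frame.refl (p : Prog) (s : State) : Frame p s s :=
  ⟨fun _ _ => rfl, fun _ _ => rfl⟩

theorem Frame.trans {p : Prog} {s s₁ s₂ : State} (h : Frame p s s₁) (h' : Frame p s₁ s₂) :
    Frame p s s₂ :=
  ⟨fun k hk => (h'.1 k hk).trans (h.1 k hk), fun k hk => (h'.2 k hk).trans (h.2 k hk)⟩

theorem Frame.mono {p q : Prog} {s s' : State} (h : Frame p s s')
    (hi : p.intWrites ⊆ q.intWrites) (hr : p.realWrites ⊆ q.realWrites) : Frame q s s' :=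
  ⟨fun k hk => h.1 k fun h' => hk (hi h'), fun k hk => h.2 k fun h' => hk (hr h')⟩

theorem setCell_of_ne {α : Type} (f : ℕ → ℕ → ℕ → α) {k k' : ℕ} (i j : ℕ) (v : α) (h : k' ≠ k) :
    setCell f k i j v k' = f k' := by
  funext i' j'
  simp [setCell, h]

/-- The lists of written arrays are syntactic, so for concrete programs the facts drawn from this
lemma are settled by `decide`. -/
theorem Run.frame {p : Prog} {s s' : State} {t : ℕ} (h : Run p s t s') : Frame p s s' := by
  induction h with
  | skip s => exact Frame.refl _ _
  | iset s k i j e =>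
    exact ⟨fun k' hk => setCell_of_ne _ _ _ _ (by simpa [Prog.intWrites] using hk),
      fun _ _ => rfl⟩
  | rset s k i j e =>
    exact ⟨fun _ _ => rfl,
      fun k' hk => setCell_of_ne _ _ _ _ (by simpa [Prog.realWrites] using hk)⟩
  | seq _ _ h₁ h₂ =>
    exact (h₁.mono (by simp [Prog.intWrites]) (by simp [Prog.realWrites])).trans
      (h₂.mono (by simp [Prog.intWrites]) (by simp [Prog.realWrites]))
  | ite_true _ _ h₁ => exact h₁.mono (by simp [Prog.intWrites]) (by simp [Prog.realWrites])
  | ite_false _ _ h₁ => exact h₁.mono (by simp [Prog.intWrites]) (by simp [Prog.realWrites])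
  | while_false _ => exact Frame.refl _ _
  | while_true _ _ _ h₁ h₂ =>
    exact (h₁.mono (by simp [Prog.intWrites]) (by simp [Prog.realWrites])).trans h₂

/-- Started in state `s`, the program `p` halts within `T` steps, in a state satisfying `Q`. -/
def Reaches (p : Prog) (s : State) (T : ℕ) (Q : State → Prop) : Prop :=
  ∃ t s', Run p s t s' ∧ t ≤ T ∧ Q s'

theorem Reaches.mono {p : Prog} {s : State} {T T' : ℕ} {Q Q' : State → Prop}
    (h : Reaches p s T Q) (hT : T ≤ T') (hQ : ∀ s', Frame p s s' → Q s' → Q' s') :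
    Reaches p s T' Q' := by
  obtain ⟨t, s', hr, ht, hq⟩ := h
  exact ⟨t, s', hr, ht.trans hT, hQ s' hr.frame hq⟩

theorem Reaches.seq {p q : Prog} {s : State} {T₁ T₂ : ℕ} {R Q : State → Prop}
    (h₁ : Reaches p s T₁ R) (h₂ : ∀ s', Frame p s s' → R s' → Reaches q s' T₂ Q) :
    Reaches (.seq p q) s (T₁ + T₂) Q := by
  obtain ⟨t₁, s₁, hr₁, ht₁, hq₁⟩ := h₁
  obtain ⟨t₂, s₂, hr₂, ht₂, hq₂⟩ := h₂ s₁ hr₁.frame hq₁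
  exact ⟨_, s₂, hr₁.seq hr₂, by omega, hq₂⟩

/-- A weakest precondition for loop-free programs. -/
def Prog.wp : Prog → (State → Prop) → State → Prop
  | .skip, Q, s => Q s
  | .iset k i j e, Q, s =>
    Q { s with ints := setCell s.ints k (i.eval s) (j.eval s) (e.eval s) }
  | .rset k i j e, Q, s =>
    Q { s with reals := setCell s.reals k (i.eval s) (j.eval s) (e.eval s) }
  | .seq p q, Q, s => p.wp (q.wp Q) s
  | .ite c p q, Q, s => (c.Holds s → p.wp Q s) ∧ (¬ c.Holds s → q.wp Q s)
  | .while _ _, _, _ => False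

/-- A time bound for loop-free programs. -/
def Prog.timeBound : Prog → ℕ
  | .skip => 1
  | .iset _ i j e => i.cost + j.cost + e.cost + 1
  | .rset _ i j e => i.cost + j.cost + e.cost + 1
  | .seq p q => p.timeBound + q.timeBound
  | .ite c p q => c.cost + (p.timeBound + q.timeBound) + 1
  | .while _ _ => 0

theorem Reaches.of_wp {p : Prog} {s : State} {Q : State → Prop} {T : ℕ} (h : p.wp Q s)
    (hT : p.timeBound ≤ T) : Reaches p s T Q := by
  refine Reaches.mono (T := p.timeBound) (Q := Q) ?_ hT fun _ _ h => h
  clear hT T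
  induction p generalizing s Q with
  | skip => exact ⟨_, _, .skip s, le_rfl, h⟩
  | iset k i j e => exact ⟨_, _, .iset s k i j e, le_rfl, h⟩
  | rset k i j e => exact ⟨_, _, .rset s k i j e, le_rfl, h⟩
  | seq p q hp hq => exact (hp h).seq fun s' _ h' => hq h'
  | ite c p q hp hq =>
    by_cases hc : c.Holds s
    · obtain ⟨t, s', hr, ht, hQ⟩ := hp (h.1 hc)
      exact ⟨_, s', .ite_true hc hr, by simp only [Prog.timeBound]; omega, hQ⟩
    · obtain ⟨t, s', hr, ht, hQ⟩ := hq (h.2 hc)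
      exact ⟨_, s', .ite_false hc hr, by simp only [Prog.timeBound]; omega, hQ⟩
  | _ => exact h.elim

theorem Reaches.ite {c : BExp} {p q : Prog} {s : State} {T₁ T₂ : ℕ} {Q : State → Prop}
    (hp : c.Holds s → Reaches p s T₁ Q) (hq : ¬ c.Holds s → Reaches q s T₂ Q) :
    Reaches (.ite c p q) s (c.cost + (T₁ + T₂) + 1) Q := by
  by_cases hc : c.Holds s
  · obtain ⟨t, s', hr, ht, hQ⟩ := hp hc
    exact ⟨_, s', .ite_true hc hr, by omega, hQ⟩
  · obtain ⟨t, s', hr, ht, hQ⟩ := hq hc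
    exact ⟨_, s', .ite_false hc hr, by omega, hQ⟩

/-- The rule for loops, with an invariant `I` and a variant `V`. -/
theorem Reaches.while_loop {c : BExp} {p : Prog} {s : State} (I : State → Prop) (V : State → ℕ)
    (n B : ℕ) (hs : I s) (hV : V s ≤ n)
    (step : ∀ s', Frame p s s' → I s' → c.Holds s' →
      Reaches p s' B fun s'' => I s'' ∧ V s'' < V s') :
    Reaches (.while c p) s (n * (B + c.cost + 1) + (c.cost + 1))
      fun s' => I s' ∧ ¬ c.Holds s' := by
  induction n generalizing s with
  | zero =>
    have hc : ¬ c.Holds s := fun hc => by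
      obtain ⟨_, s', _, _, _, h⟩ := step s (Frame.refl _ _) hs hc
      omega
    exact ⟨_, s, .while_false hc, by omega, hs, hc⟩
  | succ n ih =>
    by_cases hc : c.Holds s
    · obtain ⟨t, s₁, hr, ht, hI, hlt⟩ := step s (Frame.refl _ _) hs hc
      obtain ⟨t', s₂, hr', ht', hQ⟩ :=
        ih hI (by omega) fun s' hf => step s' (hr.frame.trans hf)
      refine ⟨_, s₂, .while_true hc hr hr', ?_, hQ⟩
      rw [add_mul]
      omega
    · exact ⟨_, s, .while_false hc, by omega, hs, hc⟩

/-- The scalar index variable `k`. -/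
abbrev ivar (k : ℕ) : IExp := .get k (.const 0) (.const 0)

/-- The entry `e` of the index vector `k`. -/
abbrev icell (k : ℕ) (e : IExp) : IExp := .get k e (.const 0)

/-- The scalar real variable `k`. -/
abbrev rvar (k : ℕ) : RExp := .get k (.const 0) (.const 0)

/-- The entry `e` of the real vector `k`. -/
abbrev rcell (k : ℕ) (e : IExp) : RExp := .get k e (.const 0)

/-- Assign a value to the scalar index variable `k`. -/
def State.setVar (s : State) (k v : ℕ) : State :=
  { s with ints := setCell s.ints k 0 0 v }

@[simp] theorem State.setVar_reals (s : State) (k v : ℕ) : (s.setVar k v).reals = s.reals := rfl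

@[simp] theorem State.setVar_self (s : State) (k v : ℕ) : (s.setVar k v).ints k 0 0 = v := by
  simp [State.setVar, setCell]

@[simp] theorem State.setVar_of_ne (s : State) {k k' : ℕ} (v : ℕ) (h : k' ≠ k) :
    (s.setVar k v).ints k' = s.ints k' := setCell_of_ne _ _ _ _ h

/-- `for k = 0, …, e - 1 do p`. -/
def forLoop (k : ℕ) (e : IExp) (p : Prog) : Prog :=
  .seq (.iset k (.const 0) (.const 0) (.const 0))
    (.while (.ilt (ivar k) e) (.seq p (.iset k (.const 0) (.const 0) (.succ (ivar k)))))

/-- The body proves the invariant for the state in which the counter has already been advanced, so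
the increment is dealt with once and for all here. The frame hypothesis `he` keeps the loop bound
constant. -/
theorem Reaches.for_loop {k : ℕ} {e : IExp} {p : Prog} {s : State} (I : ℕ → State → Prop)
    (N B : ℕ) (he : ∀ s', Frame (forLoop k e p) s s' → e.eval s' = N)
    (h0 : I 0 (s.setVar k 0))
    (step : ∀ j s', j < N → Frame (forLoop k e p) s s' → s'.ints k 0 0 = j → I j s' →
      Reaches p s' B fun s'' => s''.ints k 0 0 = j ∧ I (j + 1) (s''.setVar k (j + 1))) :
    Reaches (forLoop k e p) s (N * (B + e.cost + 12) + (e.cost + 9)) fun s' => I N s' := by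
  set q : Prog := .seq p (.iset k (.const 0) (.const 0) (.succ (ivar k))) with hq
  have hfq : ∀ {s s' : State}, Frame q s s' → Frame (forLoop k e p) s s' := fun h =>
    h.mono (by simp [Prog.intWrites, forLoop, hq]) (by simp [Prog.realWrites, forLoop, hq])
  have hf0 : Frame (forLoop k e p) s (s.setVar k 0) :=
    ⟨fun k' hk => setCell_of_ne _ _ _ _ fun h => hk (by simp [h, Prog.intWrites, forLoop]),
      fun _ _ => rfl⟩
  have h1 : Reaches (.iset k (.const 0) (.const 0) (.const 0)) s 4 fun s' => s' = s.setVar k 0 :=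
    Reaches.of_wp rfl le_rfl
  -- An increment of the counter costs `7`, a test of the loop condition `4 + e.cost`.
  refine (h1.seq (T₂ := N * (B + 7 + (4 + e.cost) + 1) + ((4 + e.cost) + 1)) ?_).mono ?_
    fun _ _ h => h
  · rintro _ - rfl
    have hw := Reaches.while_loop (c := .ilt (ivar k) e) (p := q) (s := s.setVar k 0)
      (fun s' => ∃ j ≤ N, s'.ints k 0 0 = j ∧ I j s') (fun s' => N - s'.ints k 0 0) N (B + 7)
      ⟨0, by omega, by simp, h0⟩ (by simp) ?_
    · refine hw.mono ?_ ?_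
      · simp only [BExp.cost, IExp.cost]
        apply le_of_eq
        ring
      · rintro s' hf ⟨⟨j, hj, hk, hI⟩, hc⟩
        have hN := he s' (hf0.trans (hfq hf))
        simp only [BExp.Holds, IExp.eval, hN] at hc
        obtain rfl : j = N := by omega
        exact hI
    · rintro s' hf ⟨j, hj, hk, hI⟩ hc
      have hF := hf0.trans (hfq hf)
      have hN := he s' hF
      simp only [BExp.Holds, IExp.eval, hN] at hc
      refine (step j s' (by omega) hF hk hI).seq ?_
      rintro s'' - ⟨hk', hI'⟩
      refine Reaches.of_wp ?_ (by simp [Prog.timeBound, IExp.cost])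
      have hs : ({ s'' with ints := setCell s''.ints k 0 0 (s''.ints k 0 0 + 1) } : State) =
          s''.setVar k (j + 1) := by rw [hk']; rfl
      simp only [Prog.wp, IExp.eval]
      rw [hs]
      refine ⟨⟨j + 1, by omega, by simp [setCell, hk'], hI'⟩, ?_⟩
      simp only [setCell, hk', and_self, if_true, hk]
      omega
  · apply le_of_eq
    ring

/-! ### Partial matchings and shortest augmenting paths

Rows and columns are counted from `0`. The column `N` is an extra one, and `p j` is the row that is
matched with the column `j`, where `N` stands for an unmatched column. -/

/-- The slack of the row matched with `k` at the column `j`. -/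
def slack (c : ℕ → ℕ → ℝ) (v : ℕ → ℝ) (p : ℕ → ℕ) (k j : ℕ) : ℝ :=
  c (p k) j - v j - (c (p k) k - v k)

/-- Outside the column `h`, the rows less than `r` are matched by `p`, each with a column that
minimizes the cost reduced by the potential `v`. -/
structure Tight (N r h : ℕ) (c : ℕ → ℕ → ℝ) (v : ℕ → ℝ) (p : ℕ → ℕ) : Prop where
  range : ∀ j ≤ N, j ≠ h → p j < r ∨ p j = N
  inj : ∀ j ≤ N, ∀ k ≤ N, j ≠ h → k ≠ h → p j = p k → p j ≠ N → j = k
  surj : ∀ i < r, ∃ j ≤ N, j ≠ h ∧ p j = i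
  slack_nonneg : ∀ k ≤ N, k ≠ h → p k ≠ N → ∀ j < N, 0 ≤ slack c v p k j

theorem Tight.init {N : ℕ} {c : ℕ → ℕ → ℝ} {v : ℕ → ℝ} {p : ℕ → ℕ} (hp : ∀ j < N, p j = N) :
    Tight N 0 N c v p where
  range j hj hjN := .inr (hp j (by omega))
  inj j hj k hk hjN hkN _ h := absurd (hp j (by omega)) h
  surj i hi := by omega
  slack_nonneg k hk hkN h := absurd (hp k (by omega)) h

/-- The hole `N + 1` lies beyond all columns, so the extra column `N` now counts as matched, with
the new row. The entry `c r N` may be arbitrary: only `c r N - v' N` matters, and it acts as the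
potential of the row `r`. -/
theorem Tight.insert {N r : ℕ} {c : ℕ → ℕ → ℝ} {v v' : ℕ → ℝ} {p p' : ℕ → ℕ}
    (h : Tight N r N c v p) (hr : r < N) (hpN : p' N = r) (hp : ∀ j < N, p' j = p j)
    (hv : ∀ j < N, v' j = v j) (hvN : ∀ j < N, c r N - v' N ≤ c r j - v' j) :
    Tight N (r + 1) (N + 1) c v' p' := by
  have key : ∀ j ≤ N, j = N ∨ j < N := fun j hj => by omega
  refine ⟨fun j hj _ => ?_, fun j hj k hk _ _ he hn => ?_, fun i hi => ?_,
    fun k hk _ hn j hj => ?_⟩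
  · rcases key j hj with rfl | hj'
    · omega
    · have := h.range j hj (by omega)
      rw [hp j hj']
      omega
  · rcases key j hj with rfl | hj' <;> rcases key k hk with rfl | hk'
    · rfl
    · have := h.range k hk (by omega)
      rw [← hp k hk'] at this
      omega
    · have := h.range j hj (by omega)
      rw [← hp j hj'] at this
      omega
    · rw [hp j hj', hp k hk'] at he
      rw [hp j hj'] at hn
      exact h.inj j hj k hk (by omega) (by omega) he hn
  · rcases (by omega : i = r ∨ i < r) with rfl | hi'
    · exact ⟨N, le_rfl, by omega, hpN⟩
    · obtain ⟨j, hj, hjN, he⟩ := h.surj i hi'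
      exact ⟨j, hj, by omega, by rw [hp j (by omega), he]⟩
  · rcases key k hk with rfl | hk'
    · have := hvN j hj
      rw [slack, hpN]
      linarith
    · rw [hp k hk'] at hn
      have := h.slack_nonneg k hk (by omega) hn j hj
      rw [slack] at this ⊢
      rwa [hp k hk', hv k hk', hv j hj]

/-- Declaring a free column to be the hole loses no row. The augmentation then has to move the hole
to `N`. -/
theorem Tight.of_free {N r h : ℕ} {c : ℕ → ℕ → ℝ} {v : ℕ → ℝ} {p : ℕ → ℕ}
    (H : Tight N r (N + 1) c v p) (hr : r ≤ N) (hh : p h = N) : Tight N r h c v p where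
  range j hj _ := H.range j hj (by omega)
  inj j hj k hk _ _ := H.inj j hj k hk (by omega) (by omega)
  surj i hi := by
    obtain ⟨j, hj, _, he⟩ := H.surj i hi
    exact ⟨j, hj, by rintro rfl; omega, he⟩
  slack_nonneg k hk _ := H.slack_nonneg k hk (by omega)

/-- Moving a row along a tight edge moves the hole of a partial matching. -/
theorem Tight.shift {N r h w : ℕ} {c : ℕ → ℕ → ℝ} {v : ℕ → ℝ} {p p' : ℕ → ℕ}
    (H : Tight N r h c v p) (hh : h < N) (hw : w ≤ N) (hwh : w ≠ h) (hpw : p w ≠ N)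
    (hs : slack c v p w h = 0) (hph : p' h = p w) (hp : ∀ j, j ≠ h → p' j = p j) :
    Tight N r w c v p' := by
  refine ⟨fun j hj hjw => ?_, fun j hj k hk hjw hkw he hn => ?_, fun i hi => ?_,
    fun k hk hkw hn j hj => ?_⟩
  · by_cases hjh : j = h
    · subst hjh
      rw [hph]
      exact H.range w hw hwh
    · rw [hp j hjh]
      exact H.range j hj hjh
  · by_cases hjh : j = h <;> by_cases hkh : k = h
    · omega
    · subst hjh
      rw [hph, hp k hkh] at he
      exact absurd (H.inj w hw k hk hwh hkh he hpw) (Ne.symm hkw)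
    · subst hkh
      rw [hph, hp j hjh] at he
      exact absurd (H.inj w hw j hj hwh hjh he.symm hpw) (Ne.symm hjw)
    · rw [hp j hjh, hp k hkh] at he
      rw [hp j hjh] at hn
      exact H.inj j hj k hk hjh hkh he hn
  · obtain ⟨j, hj, hjh, he⟩ := H.surj i hi
    by_cases hjw : j = w
    · exact ⟨h, hh.le, hwh.symm, by rw [hph, ← hjw, he]⟩
    · exact ⟨j, hj, hjw, by rw [hp j hjh, he]⟩
  · by_cases hkh : k = h
    · subst hkh
      -- As the edge is tight, the moved row has the same reduced cost at its new column as at `w`,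
      -- so its slacks do not change.
      have := H.slack_nonneg w hw hwh hpw j hj
      rw [slack] at hs this ⊢
      rw [hph]
      linarith
    · rw [hp k hkh] at hn
      have := H.slack_nonneg k hk hkh hn j hj
      rw [slack] at this ⊢
      rwa [hp k hkh]

/-- If all columns up to `N` were matched, there would be too many rows. -/
theorem Tight.exists_free {N r : ℕ} {c : ℕ → ℕ → ℝ} {v : ℕ → ℝ} {p : ℕ → ℕ}
    (H : Tight N r (N + 1) c v p) (hr : r ≤ N) : ∃ j ≤ N, p j = N := by
  by_contra! hn
  have hlt : ∀ j ∈ Finset.range (N + 1), p j ∈ Finset.range N := fun j hj => by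
    have hj' : j ≤ N := by simpa [Nat.lt_succ_iff] using hj
    have := H.range j hj' (by omega)
    have := hn j hj'
    simp only [Finset.mem_range]
    omega
  obtain ⟨j, hj, k, hk, hne, he⟩ :=
    Finset.exists_ne_map_eq_of_card_lt_of_maps_to (by simp) hlt
  simp only [Finset.mem_range] at hj hk
  exact hne (H.inj j (by omega) k (by omega) (by omega) (by omega) he (hn j (by omega)))

/-! ### Search for a free column with changing potentials -/

/-- The number of columns that have not been scanned. -/
def unscanned (N : ℕ) (used : ℕ → ℕ) : ℕ := ((Finset.range N).filter fun j => used j = 0).card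

/-- The state of a search for a free column: `minv j` is the least slack of the scanned columns at
the unscanned column `j`, attained by `way j`; the last scanned column `j₀` has not been taken into
account. The numbers `rank j` witness that the links `way` lead from scanned columns to `N`. -/
structure Search (N : ℕ) (c : ℕ → ℕ → ℝ) (v : ℕ → ℝ) (p : ℕ → ℕ) (minv : ℕ → ℝ)
    (way used : ℕ → ℕ) (j₀ : ℕ) (rank : ℕ → ℕ) : Prop where
  used_last : used N ≠ 0
  le : j₀ ≤ N
  used_start : used j₀ ≠ 0
  matched : ∀ k ≤ N, used k ≠ 0 → k ≠ j₀ → p k ≠ N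
  way_spec : ∀ j < N, way j ≤ N ∧ used (way j) ≠ 0 ∧ p (way j) ≠ N
  minv_eq : ∀ j < N, used j = 0 → minv j = slack c v p (way j) j
  minv_le : ∀ j < N, used j = 0 → ∀ k ≤ N, used k ≠ 0 → k ≠ j₀ → minv j ≤ slack c v p k j
  tree : ∀ j < N, used j ≠ 0 → slack c v p (way j) j = 0 ∧ rank (way j) < rank j
  rank_le : ∀ j ≤ N, used j ≠ 0 → rank j + unscanned N used ≤ N

theorem unscanned_le (N : ℕ) (used : ℕ → ℕ) : unscanned N used ≤ N :=
  (Finset.card_filter_le _ _).trans (by simp)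

/-- Starting `minv` with the slacks of the column `N` avoids an infinite initial value and gives
every column a valid link. -/
theorem Search.init {N : ℕ} {c : ℕ → ℕ → ℝ} {v : ℕ → ℝ} {p : ℕ → ℕ} {minv : ℕ → ℝ}
    {way used : ℕ → ℕ} (hu : used N ≠ 0) (hu' : ∀ j < N, used j = 0) (hp : p N ≠ N)
    (hw : ∀ j < N, way j = N) (hm : ∀ j < N, minv j = slack c v p N j) :
    Search N c v p minv way used N (fun _ => 0) where
  used_last := hu
  le := le_rfl
  used_start := hu
  matched k hk hk' hkN := absurd (hu' k (by omega)) hk'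
  way_spec j hj := by simp [hw j hj, hu, hp]
  minv_eq j hj _ := by rw [hw j hj, hm j hj]
  minv_le j hj _ k hk hk' hkN := absurd (hu' k (by omega)) hk'
  tree j hj hj' := absurd (hu' j hj) hj'
  rank_le j hj _ := by simpa using unscanned_le N used

theorem unscanned_update {N : ℕ} {used used' : ℕ → ℕ} {j₁ : ℕ} (hj : j₁ < N) (hu : used j₁ = 0)
    (hu₁ : used' j₁ ≠ 0) (hu' : ∀ j, j ≠ j₁ → used' j = used j) :
    unscanned N used' + 1 = unscanned N used := by
  have : (Finset.range N).filter (fun j => used j = 0) =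
      insert j₁ ((Finset.range N).filter fun j => used' j = 0) := by
    ext j
    by_cases h : j = j₁
    · subst h; simp [hj, hu]
    · simp [h, hu' j h]
  rw [unscanned, unscanned, this, Finset.card_insert_of_notMem (by simp [hu₁])]

/-- `minv` and `way` after taking the column `j₀` into account. -/
structure Relaxed (c : ℕ → ℕ → ℝ) (v : ℕ → ℝ) (p : ℕ → ℕ) (j₀ : ℕ) (used : ℕ → ℕ)
    (minv minv₁ : ℕ → ℝ) (way way₁ : ℕ → ℕ) (j : ℕ) : Prop where
  unused : used j = 0 → minv₁ j ≤ minv j ∧ minv₁ j ≤ slack c v p j₀ j ∧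
    (minv₁ j = minv j ∧ way₁ j = way j ∨ minv₁ j = slack c v p j₀ j ∧ way₁ j = j₀)
  used : used j ≠ 0 → way₁ j = way j

/-- Lowering `v` by `δ = minv₁ j₁` on the scanned columns lowers the slack of a scanned column at an
unscanned one by `δ`, and leaves slacks between scanned columns, hence the links of the tree,
unchanged. Slacks of unscanned columns can only grow, since `δ ≥ 0`. Minimality of `δ` keeps
everything nonnegative, and the link to `j₁` becomes tight. -/
theorem Search.step {N r : ℕ} {c : ℕ → ℕ → ℝ} {v v' : ℕ → ℝ} {p : ℕ → ℕ}
    {minv minv₁ minv' : ℕ → ℝ} {way way₁ used used' : ℕ → ℕ} {j₀ j₁ : ℕ} {rank : ℕ → ℕ}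
    (S : Search N c v p minv way used j₀ rank) (H : Tight N r (N + 1) c v p) (hp : p j₀ ≠ N)
    (hR : ∀ j < N, Relaxed c v p j₀ used minv minv₁ way way₁ j)
    (hj : j₁ < N) (hu : used j₁ = 0)
    (hmin : ∀ j < N, used j = 0 → minv₁ j₁ ≤ minv₁ j)
    (hv : ∀ j ≤ N, used j ≠ 0 → v' j = v j - minv₁ j₁) (hv₀ : ∀ j ≤ N, used j = 0 → v' j = v j)
    (hm : ∀ j < N, used j = 0 → minv' j = minv₁ j - minv₁ j₁)
    (hu₁ : used' j₁ ≠ 0) (hu' : ∀ j, j ≠ j₁ → used' j = used j) :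
    (∃ rank', Search N c v' p minv' way₁ used' j₁ rank') ∧ Tight N r (N + 1) c v' p := by
  have hmatched : ∀ k ≤ N, used k ≠ 0 → p k ≠ N := fun k hk hk' => by
    by_cases h : k = j₀
    · rwa [h]
    · exact S.matched k hk hk' h
  have hway : ∀ j < N, way₁ j ≤ N ∧ used (way₁ j) ≠ 0 ∧ p (way₁ j) ≠ N := fun j hj => by
    by_cases h : used j = 0
    · rcases ((hR j hj).unused h).2.2 with h' | h'
      · rw [h'.2]; exact S.way_spec j hj
      · rw [h'.2]; exact ⟨S.le, S.used_start, hp⟩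
    · rw [(hR j hj).used h]; exact S.way_spec j hj
  have heq : ∀ j < N, used j = 0 → minv₁ j = slack c v p (way₁ j) j := fun j hj h => by
    rcases ((hR j hj).unused h).2.2 with h' | h'
    · rw [h'.2, h'.1, S.minv_eq j hj h]
    · rw [h'.2, h'.1]
  have hle : ∀ j < N, used j = 0 → ∀ k ≤ N, used k ≠ 0 → minv₁ j ≤ slack c v p k j := by
    intro j hj h k hk hk'
    by_cases hkj : k = j₀
    · rw [hkj]; exact ((hR j hj).unused h).2.1
    · exact ((hR j hj).unused h).1.trans (S.minv_le j hj h k hk hk' hkj)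
  have hnn : 0 ≤ minv₁ j₁ := by
    rw [heq j₁ hj hu]
    have := hway j₁ hj
    exact H.slack_nonneg _ this.1 (by omega) this.2.2 _ hj
  have hs₁ : ∀ k ≤ N, used k ≠ 0 → ∀ j < N, used j = 0 →
      slack c v' p k j = slack c v p k j - minv₁ j₁ := fun k hk hk' j hj hj' => by
    rw [slack, slack, hv k hk hk', hv₀ j hj.le hj']; ring
  have hs₂ : ∀ k ≤ N, used k ≠ 0 → ∀ j < N, used j ≠ 0 →
      slack c v' p k j = slack c v p k j := fun k hk hk' j hj hj' => by
    rw [slack, slack, hv k hk hk', hv j hj.le hj']; ring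
  have hused : ∀ k, used k ≠ 0 → used' k ≠ 0 := fun k hk => by
    rwa [hu' k fun h => hk (h ▸ hu)]
  have hused' : ∀ k, used' k ≠ 0 → k ≠ j₁ → used k ≠ 0 := fun k hk h => by rwa [← hu' k h]
  have hused₀ : ∀ k, used' k = 0 → used k = 0 := fun k hk => by
    rwa [← hu' k fun h => hu₁ (h ▸ hk)]
  have hcard := unscanned_update hj hu hu₁ hu'
  -- The new rank is the number of columns below `N` scanned so far, including `j₁`; by `rank_le` it
  -- exceeds all earlier ranks.
  refine ⟨⟨fun j => if j = j₁ then N - unscanned N used' else rank j, ?_⟩, ?_⟩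
  · refine ⟨hused _ S.used_last, hj.le, hu₁, fun k hk hk' h => hmatched k hk (hused' k hk' h),
      fun j hj => ⟨(hway j hj).1, hused _ (hway j hj).2.1, (hway j hj).2.2⟩, fun j hj h => ?_,
      fun j hj h k hk hk' hkj => ?_, fun j hj' h => ?_, fun j hj' h => ?_⟩
    · rw [hm j hj (hused₀ j h), hs₁ _ (hway j hj).1 (hway j hj).2.1 j hj (hused₀ j h),
        heq j hj (hused₀ j h)]
    · rw [hm j hj (hused₀ j h), hs₁ k hk (hused' k hk' hkj) j hj (hused₀ j h)]
      exact sub_le_sub_right (hle j hj (hused₀ j h) k hk (hused' k hk' hkj)) _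
    · have hw := hway j hj'
      have hne : way₁ j ≠ j₁ := fun h' => hw.2.1 (h' ▸ hu)
      simp only [hne, if_false]
      by_cases hjj : j = j₁
      · subst hjj
        rw [hs₁ _ hw.1 hw.2.1 j hj' hu, heq j hj' hu]
        have := S.rank_le _ hw.1 hw.2.1
        simp only [if_true, sub_self, true_and]
        omega
      · have hu₂ := hused' j h hjj
        simp only [hjj, if_false]
        rw [hs₂ _ hw.1 hw.2.1 j hj' hu₂, (hR j hj').used hu₂]
        exact S.tree j hj' hu₂
    · have := unscanned_le N used'
      by_cases hjj : j = j₁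
      · simp only [hjj, if_true]
        omega
      · have := S.rank_le j hj' (hused' j h hjj)
        simp only [hjj, if_false]
        omega
  · refine ⟨H.range, H.inj, H.surj, fun k hk hkN hpk j hj => ?_⟩
    have h0 := H.slack_nonneg k hk hkN hpk j hj
    by_cases hk' : used k = 0
    · have hvj : v' j ≤ v j := by
        by_cases hj' : used j = 0
        · rw [hv₀ j hj.le hj']
        · rw [hv j hj.le hj']; linarith
      rw [slack] at h0 ⊢
      rw [hv₀ k hk hk']
      linarith
    · by_cases hj' : used j = 0
      · rw [hs₁ k hk hk' j hj hj']
        linarith [hle j hj hj' k hk hk', hmin j hj hj']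
      · rwa [hs₂ k hk hk' j hj hj']

/-- Some column is free by counting, and it cannot have been scanned: all scanned columns, now
including `j₀`, are matched. -/
theorem Search.exists_unused {N r : ℕ} {c : ℕ → ℕ → ℝ} {v : ℕ → ℝ} {p : ℕ → ℕ}
    {minv : ℕ → ℝ} {way used : ℕ → ℕ} {j₀ : ℕ} {rank : ℕ → ℕ}
    (S : Search N c v p minv way used j₀ rank) (H : Tight N r (N + 1) c v p) (hr : r ≤ N)
    (hp : p j₀ ≠ N) : ∃ j < N, used j = 0 := by
  obtain ⟨j, hj, he⟩ := H.exists_free hr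
  by_contra! hn
  have hu : used j ≠ 0 := by
    rcases (by omega : j = N ∨ j < N) with rfl | h
    · exact S.used_last
    · exact hn j h
  exact S.matched j hj hu (by rintro rfl; exact hp he) he

/-! ### Augmentation along the links of the search -/

/-- The state of an augmentation along the links `way`, with the hole `h`. -/
structure Augment (N r : ℕ) (c : ℕ → ℕ → ℝ) (v : ℕ → ℝ) (p₀ p way used rank : ℕ → ℕ) (h : ℕ) :
    Prop where
  tight : Tight N r h c v p
  le : h ≤ N
  scanned : used h ≠ 0
  eq : ∀ j, rank j < rank h → p j = p₀ j
  way_spec : ∀ j < N, way j ≤ N ∧ used (way j) ≠ 0 ∧ p₀ (way j) ≠ N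
  tree : ∀ j < N, used j ≠ 0 → slack c v p₀ (way j) j = 0 ∧ rank (way j) < rank j

theorem Search.augment {N r : ℕ} {c : ℕ → ℕ → ℝ} {v : ℕ → ℝ} {p : ℕ → ℕ} {minv : ℕ → ℝ}
    {way used : ℕ → ℕ} {j₀ : ℕ} {rank : ℕ → ℕ} (S : Search N c v p minv way used j₀ rank)
    (H : Tight N r (N + 1) c v p) (hr : r ≤ N) (hp : p j₀ = N) :
    Augment N r c v p p way used rank j₀ where
  tight := H.of_free hr hp
  le := S.le
  scanned := S.used_start
  eq _ _ := rfl
  way_spec := S.way_spec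
  tree := S.tree

/-- Columns of rank below that of the hole still hold their original rows. The link `way h` is one
of them, so the tightness recorded for `p₀` applies to the current matching. -/
theorem Augment.step {N r : ℕ} {c : ℕ → ℕ → ℝ} {v : ℕ → ℝ} {p₀ p p' way used rank : ℕ → ℕ}
    {h : ℕ} (A : Augment N r c v p₀ p way used rank h) (hh : h ≠ N)
    (hph : p' h = p (way h)) (hp : ∀ j, j ≠ h → p' j = p j) :
    Augment N r c v p₀ p' way used rank (way h) ∧ rank (way h) < rank h := by
  have hN : h < N := lt_of_le_of_ne A.le hh
  obtain ⟨hw, hwu, hwp⟩ := A.way_spec h hN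
  obtain ⟨hs, hlt⟩ := A.tree h hN A.scanned
  have he : p (way h) = p₀ (way h) := A.eq _ hlt
  have hne : way h ≠ h := fun h' => by rw [h'] at hlt; omega
  refine ⟨⟨A.tight.shift hN hw hne (by rwa [he]) ?_ hph hp, hw, hwu, fun j hj => ?_, A.way_spec,
    A.tree⟩, hlt⟩
  · rw [slack] at hs ⊢
    rwa [he]
  · rw [hp j fun h' => by subst h'; omega, A.eq j (by omega)]

/-! ### A program for the linear assignment problem

Index arrays: `2` the size `N`, `3` the current row, `4` a loop counter, `5` the matching, `6` the
links of the search, `7` the scanned columns, `8` the last scanned column, `9` an auxiliary column.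
Real arrays: `6` the costs, `7` the potential, `8` the least slacks, `9` an auxiliary number,
`10` the solution. -/

/-- The `k`-th index array as a vector. -/
def State.ivec (s : State) (k : ℕ) : ℕ → ℕ := fun j => s.ints k j 0

/-- The `k`-th real array as a vector. -/
def State.rvec (s : State) (k : ℕ) : ℕ → ℝ := fun j => s.reals k j 0

@[simp] theorem State.ivec_apply (s : State) (k j : ℕ) : s.ivec k j = s.ints k j 0 := rfl

@[simp] theorem State.rvec_apply (s : State) (k j : ℕ) : s.rvec k j = s.reals k j 0 := rfl

theorem State.ivec_congr {s s' : State} {k : ℕ} (h : s'.ints k = s.ints k) :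
    s'.ivec k = s.ivec k := by
  funext j
  simp [h]

theorem State.rvec_congr {s s' : State} {k : ℕ} (h : s'.reals k = s.reals k) :
    s'.rvec k = s.rvec k := by
  funext j
  simp [h]

/-- The cost `12` of entering and leaving the loop is charged to the iterations, which is where `1 ≤
N` is needed. -/
theorem Reaches.for_size {k : ℕ} {p : Prog} {s : State} {N : ℕ} (I : ℕ → State → Prop) (B : ℕ)
    (hN : s.ints 2 0 0 = N) (hN1 : 1 ≤ N) (hk : 2 ∉ (forLoop k (ivar 2) p).intWrites)
    (h0 : I 0 (s.setVar k 0))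
    (step : ∀ j s', j < N → Frame (forLoop k (ivar 2) p) s s' → s'.ints k 0 0 = j →
      s'.ints 2 0 0 = N → I j s' →
      Reaches p s' B fun s'' => s''.ints k 0 0 = j ∧ I (j + 1) (s''.setVar k (j + 1))) :
    Reaches (forLoop k (ivar 2) p) s (N * (B + 27)) fun s' => I N s' := by
  have he : ∀ s', Frame (forLoop k (ivar 2) p) s s' → s'.ints 2 0 0 = N := fun s' hf => by
    rw [hf.1 2 hk, hN]
  refine (Reaches.for_loop I N B he h0 fun j s' hj hf hk hI =>
    step j s' hj hf hk (he s' hf) hI).mono ?_ fun _ _ h => h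
  simp only [IExp.cost]
  nlinarith

/-- Unmatch all columns. -/
def lapInit : Prog := forLoop 4 (ivar 2) (.iset 5 (ivar 4) (.const 0) (ivar 2))

theorem lapInit_spec {s : State} {N : ℕ} (hN : s.ints 2 0 0 = N) (hN1 : 1 ≤ N) :
    Reaches lapInit s (100 * N) fun s' => ∀ j < N, s'.ints 5 j 0 = N := by
  refine (Reaches.for_size (fun j s' => ∀ k < j, s'.ints 5 k 0 = N) 50 hN hN1 (by decide)
    (by simp) ?_).mono (by omega) fun _ _ h => h
  intro j s' hj hf hk hN hI
  refine Reaches.of_wp ?_ (by decide)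
  simp only [Prog.wp, IExp.eval, hk, hN]
  refine ⟨by simp [setCell, hk], fun i hi => ?_⟩
  rw [State.setVar_of_ne _ _ (by decide)]
  by_cases h : i = j
  · simp [setCell, h]
  · simp [setCell, h, hI i (by omega)]

/-- The reduced cost of the row `i` at the column `j`. -/
abbrev reducedCost (i j : IExp) : RExp := .sub (.get 6 i j) (rcell 7 j)

/-- Match the current row with the column `N`. -/
def lapInsert : Prog :=
  .seq (.iset 5 (ivar 2) (.const 0) (ivar 3))
    (forLoop 4 (ivar 2)
      (.ite (.rlt (reducedCost (ivar 3) (ivar 4)) (reducedCost (ivar 3) (ivar 2)))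
        (.rset 7 (ivar 2) (.const 0)
          (.sub (.get 6 (ivar 3) (ivar 2)) (reducedCost (ivar 3) (ivar 4)))) .skip))

theorem lapInsert_spec {s : State} {N r : ℕ} (hN : s.ints 2 0 0 = N) (hr : s.ints 3 0 0 = r)
    (hrN : r < N) (H : Tight N r N (s.reals 6) (s.rvec 7) (s.ivec 5)) :
    Reaches lapInsert s (200 * N) fun s' =>
      s'.ints 5 N 0 = r ∧ Tight N (r + 1) (N + 1) (s.reals 6) (s'.rvec 7) (s'.ivec 5) := by
  refine (Reaches.seq (T₁ := 10) (T₂ := N * (100 + 27))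
    (R := fun s' => s' = { s with ints := setCell s.ints 5 N 0 r })
    (Reaches.of_wp (by simp [Prog.wp, IExp.eval, hN, hr]) (by decide)) ?_).mono (by omega)
    fun _ _ h => h
  rintro _ - rfl
  set s₁ : State := { s with ints := setCell s.ints 5 N 0 r } with hs₁
  have hi : s₁.ints 5 = setCell s.ints 5 N 0 r 5 := rfl
  have hN' : s₁.ints 2 0 0 = N := by simp [hs₁, setCell, hN]
  have hr' : s₁.ints 3 0 0 = r := by simp [hs₁, setCell, hr]
  refine (Reaches.for_size (fun j s' => (∀ k < N, s'.reals 7 k 0 = s.reals 7 k 0) ∧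
    ∀ k < j, s.reals 6 r N - s'.reals 7 N 0 ≤ s.reals 6 r k - s.reals 7 k 0) 100 hN' (by omega)
    (by decide) (by simp [hs₁]) ?_).mono le_rfl ?_
  · rintro j s' hj hf hk hN ⟨hI, hI'⟩
    have hr₂ : s'.ints 3 0 0 = r := by rw [hf.1 3 (by decide), hr']
    have hc : s'.reals 6 = s.reals 6 := hf.2 6 (by decide)
    refine Reaches.of_wp ?_ (by decide)
    simp only [Prog.wp, IExp.eval, BExp.Holds, RExp.eval, hk, hN, hr₂, hc, State.setVar_reals]
    refine ⟨fun h => ⟨trivial, fun k hk => ?_, fun k hk => ?_⟩,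
      fun h => ⟨trivial, hI, fun k hk => ?_⟩⟩
    · simp [setCell, hk.ne, hI k hk]
    · simp only [setCell, and_self, if_true]
      rw [hI j hj] at h ⊢
      rcases (by omega : k = j ∨ k < j) with rfl | hk
      · linarith
      · linarith [hI' k hk]
    · rcases (by omega : k = j ∨ k < j) with rfl | hk
      · rw [hI k hj] at h
        linarith
      · exact hI' k hk
  · rintro s' hf ⟨h1, h2⟩
    have hp : s'.ints 5 = setCell s.ints 5 N 0 r 5 := hf.1 5 (by decide)
    have hpN : s'.ints 5 N 0 = r := by simp [hp, setCell]
    refine ⟨hpN, H.insert hrN hpN (fun j hj => ?_) h1 fun j hj => ?_⟩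
    · simp [hp, setCell, hj.ne]
    · have := h2 j hj
      rwa [← h1 j hj] at this

/-- Start a search at the column `N`. -/
def lapStart : Prog :=
  .seq (.seq (.iset 7 (ivar 2) (.const 0) (.const 1)) (.iset 8 (.const 0) (.const 0) (ivar 2)))
    (forLoop 4 (ivar 2)
      (.seq (.iset 7 (ivar 4) (.const 0) (.const 0))
        (.seq (.iset 6 (ivar 4) (.const 0) (ivar 2))
          (.rset 8 (ivar 4) (.const 0)
            (.sub (reducedCost (ivar 3) (ivar 4)) (reducedCost (ivar 3) (ivar 2)))))))

/-- The invariant of the search for a free column. -/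
def Searching (N r : ℕ) (c : ℕ → ℕ → ℝ) (s : State) : Prop :=
  (∃ rank, Search N c (s.rvec 7) (s.ivec 5) (s.rvec 8) (s.ivec 6) (s.ivec 7) (s.ints 8 0 0) rank) ∧
    Tight N r (N + 1) c (s.rvec 7) (s.ivec 5)

theorem lapStart_spec {s : State} {N r : ℕ} (hN : s.ints 2 0 0 = N) (hr : s.ints 3 0 0 = r)
    (hrN : r < N) (hp : s.ints 5 N 0 = r)
    (H : Tight N (r + 1) (N + 1) (s.reals 6) (s.rvec 7) (s.ivec 5)) :
    Reaches lapStart s (200 * N) (Searching N (r + 1) (s.reals 6)) := by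
  refine (Reaches.seq (T₁ := 30) (T₂ := N * (100 + 27))
    (R := fun s' => s'.ints 7 N 0 = 1 ∧ s'.ints 8 0 0 = N)
    (Reaches.of_wp (by simp [Prog.wp, IExp.eval, hN, setCell]) (by decide)) ?_).mono (by omega)
    fun _ _ h => h
  rintro s₁ hf₁ ⟨h7, h8⟩
  have hN' : s₁.ints 2 0 0 = N := by rw [hf₁.1 2 (by decide), hN]
  have hr' : s₁.ints 3 0 0 = r := by rw [hf₁.1 3 (by decide), hr]
  have hc' : s₁.reals = s.reals := funext fun k => hf₁.2 k (by simp [Prog.realWrites])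
  refine (Reaches.for_size (fun j s' => s'.ints 7 N 0 = 1 ∧ ∀ k < j, s'.ints 7 k 0 = 0 ∧
    s'.ints 6 k 0 = N ∧ s'.reals 8 k 0 =
      s.reals 6 r k - s.reals 7 k 0 - (s.reals 6 r N - s.reals 7 N 0)) 100 hN' (by omega)
    (by decide) (by simp [h7]) ?_).mono le_rfl ?_
  · rintro j s' hj hf hk hN ⟨hI, hI'⟩
    have hr₂ : s'.ints 3 0 0 = r := by rw [hf.1 3 (by decide), hr']
    have hc : s'.reals 6 = s.reals 6 := by rw [hf.2 6 (by decide), hc']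
    have hv : s'.reals 7 = s.reals 7 := by rw [hf.2 7 (by decide), hc']
    refine Reaches.of_wp ?_ (by decide)
    simp only [Prog.wp, IExp.eval, RExp.eval]
    refine ⟨by simp [setCell, hk], ?_⟩
    rw [State.setVar_of_ne _ _ (by decide), State.setVar_of_ne _ _ (by decide)]
    refine ⟨by simp [setCell, hk, hj.ne', hI], fun k hkj => ?_⟩
    by_cases h : k = j
    · simp [setCell, hk, hN, hr₂, hc, hv, h]
    · simpa [setCell, hk, h] using hI' k (by omega)
  · rintro s' hf ⟨h1, h2⟩
    have hp' : s'.ints 5 = s.ints 5 := by rw [hf.1 5 (by decide), hf₁.1 5 (by decide)]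
    have hv : s'.reals 7 = s.reals 7 := by rw [hf.2 7 (by decide), hc']
    have h8' : s'.ints 8 0 0 = N := by rw [hf.1 8 (by decide), h8]
    have hpN : s'.ints 5 N 0 = r := by rw [hp', hp]
    refine ⟨⟨fun _ => 0, ?_⟩, ?_⟩
    · rw [h8']
      refine Search.init (by simp [h1]) (fun j hj => (h2 j hj).1) (by rw [State.ivec_apply]; omega)
        (fun j hj => (h2 j hj).2.1) fun j hj => ?_
      simp [(h2 j hj).2.2, slack, hpN, hv]
    · rwa [State.rvec_congr hv, State.ivec_congr hp']

/-- The slack of the last scanned column at the column `4`. -/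
abbrev currentSlack : RExp :=
  .sub (reducedCost (icell 5 (ivar 8)) (ivar 4)) (reducedCost (icell 5 (ivar 8)) (ivar 8))

/-- Take the last scanned column into account. -/
def lapRelax : Prog :=
  forLoop 4 (ivar 2)
    (.ite (.conj (.ieq (icell 7 (ivar 4)) (.const 0)) (.rlt currentSlack (rcell 8 (ivar 4))))
      (.seq (.rset 8 (ivar 4) (.const 0) currentSlack)
        (.iset 6 (ivar 4) (.const 0) (ivar 8))) .skip)

theorem lapRelax_spec {s : State} {N : ℕ} (hN : s.ints 2 0 0 = N) (hN1 : 1 ≤ N) :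
    Reaches lapRelax s (200 * N) fun s' => ∀ j < N,
      Relaxed (s.reals 6) (s.rvec 7) (s.ivec 5) (s.ints 8 0 0) (s.ivec 7) (s.rvec 8) (s'.rvec 8)
        (s.ivec 6) (s'.ivec 6) j := by
  -- The second clause says that columns not yet visited still have their old values, so each
  -- comparison is with the old `minv`.
  refine (Reaches.for_size (fun j s' => (∀ k < j,
      Relaxed (s.reals 6) (s.rvec 7) (s.ivec 5) (s.ints 8 0 0) (s.ivec 7) (s.rvec 8) (s'.rvec 8)
        (s.ivec 6) (s'.ivec 6) k) ∧
      ∀ k, j ≤ k → s'.rvec 8 k = s.rvec 8 k ∧ s'.ivec 6 k = s.ivec 6 k) 150 hN hN1 (by decide)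
    (by simp) ?_).mono (by omega) fun _ _ h => h.1
  rintro j s' hj hf hk hN ⟨hI, hI'⟩
  have h5 : s'.ints 5 = s.ints 5 := hf.1 5 (by decide)
  have h7 : s'.ints 7 = s.ints 7 := hf.1 7 (by decide)
  have h8 : s'.ints 8 = s.ints 8 := hf.1 8 (by decide)
  have hc : s'.reals 6 = s.reals 6 := hf.2 6 (by decide)
  have hv : s'.reals 7 = s.reals 7 := hf.2 7 (by decide)
  have hm : s'.reals 8 j 0 = s.reals 8 j 0 := (hI' j le_rfl).1
  have hw : s'.ints 6 j 0 = s.ints 6 j 0 := (hI' j le_rfl).2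
  refine Reaches.of_wp ?_ (by decide)
  simp only [Prog.wp, IExp.eval, RExp.eval, BExp.Holds, hk, h5, h7, h8, hc, hv, hm]
  constructor
  · rintro ⟨hu, hlt⟩
    simp only [State.rvec_apply, State.ivec_apply] at hI' ⊢
    rw [State.setVar_of_ne _ _ (by decide)]
    refine ⟨by simp [setCell, hk], fun k hkj => ?_, fun k hkj => ?_⟩
    · by_cases h : k = j
      · subst h
        refine ⟨fun _ => ?_, fun h => absurd hu h⟩
        simpa [setCell, slack] using hlt.le
      · have := hI k (by omega)
        constructor
        · simpa [setCell, h] using this.unused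
        · simpa [setCell, h] using this.used
    · have hne : k ≠ j := by omega
      simpa [setCell, hne] using hI' k (by omega)
  · intro hn
    simp only [State.rvec_apply, State.ivec_apply] at hI' ⊢
    rw [State.setVar_of_ne _ _ (by decide)]
    refine ⟨trivial, fun k hkj => ?_, fun k hkj => hI' k (by omega)⟩
    rcases (by omega : k = j ∨ k < j) with rfl | h
    · refine ⟨fun hu => ?_, fun _ => hw⟩
      simp only [State.rvec_apply, State.setVar_reals, hm]
      exact ⟨le_rfl, not_lt.1 fun h => hn ⟨hu, h⟩, .inl ⟨trivial, hw⟩⟩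
    · exact hI k h

/-- Find an unscanned column with the least slack. -/
def lapPick : Prog :=
  .seq (.iset 9 (.const 0) (.const 0) (ivar 2))
    (forLoop 4 (ivar 2)
      (.ite (.conj (.ieq (icell 7 (ivar 4)) (.const 0))
          (.neg (.conj (.neg (.ieq (ivar 9) (ivar 2)))
            (.neg (.rlt (rcell 8 (ivar 4)) (rcell 8 (ivar 9)))))))
        (.iset 9 (.const 0) (.const 0) (ivar 4)) .skip))

theorem lapPick_spec {s : State} {N : ℕ} (hN : s.ints 2 0 0 = N) (hN1 : 1 ≤ N)
    (hu : ∃ j < N, s.ints 7 j 0 = 0) :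
    Reaches lapPick s (200 * N) fun s' => ∃ j₁ < N, s'.ints 9 0 0 = j₁ ∧ s.ints 7 j₁ 0 = 0 ∧
      ∀ j < N, s.ints 7 j 0 = 0 → s.reals 8 j₁ 0 ≤ s.reals 8 j 0 := by
  refine (Reaches.seq (T₁ := 10) (T₂ := N * (100 + 27)) (R := fun s' => s'.ints 9 0 0 = N)
    (Reaches.of_wp (by simp [Prog.wp, IExp.eval, hN, setCell]) (by decide)) ?_).mono (by omega)
    fun _ _ h => h
  intro s₁ hf₁ h9
  have hN' : s₁.ints 2 0 0 = N := by rw [hf₁.1 2 (by decide), hN]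
  -- The value `N` of the variable `9` means that no unscanned column has been met yet; `hu`
  -- excludes this at the end.
  refine (Reaches.for_size (fun j s' =>
      (s'.ints 9 0 0 = N ∧ ∀ k < j, s.ints 7 k 0 ≠ 0) ∨
      ∃ j₁ < N, s'.ints 9 0 0 = j₁ ∧ s.ints 7 j₁ 0 = 0 ∧
        ∀ k < j, s.ints 7 k 0 = 0 → s.reals 8 j₁ 0 ≤ s.reals 8 k 0) 100 hN' (by omega)
    (by decide) (by simp [h9]) ?_).mono le_rfl ?_
  · intro j s' hj hf hk hN hI
    have h7 : s'.ints 7 = s.ints 7 := by rw [hf.1 7 (by decide), hf₁.1 7 (by decide)]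
    have hm : s'.reals 8 = s.reals 8 := by rw [hf.2 8 (by decide), hf₁.2 8 (by decide)]
    refine Reaches.of_wp ?_ (by decide)
    simp only [Prog.wp, IExp.eval, RExp.eval, BExp.Holds, hk, h7, hm, hN]
    constructor
    · rintro ⟨hu, hlt⟩
      refine ⟨by simp [setCell, hk], .inr ⟨j, hj, by simp [setCell, State.setVar], hu,
        fun k hkj hk' => ?_⟩⟩
      rcases (by omega : k = j ∨ k < j) with rfl | h
      · exact le_rfl
      rcases hI with ⟨_, hI⟩ | ⟨j₁, hj₁, he, _, hI⟩
      · exact absurd hk' (hI k h)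
      · refine le_trans (not_lt.1 fun h' => hlt ⟨by omega, ?_⟩) (hI k h hk')
        rw [he]
        exact h'.not_gt
    · intro hn
      rw [State.setVar_of_ne _ _ (by decide)]
      refine ⟨trivial, ?_⟩
      rcases hI with ⟨he, hI⟩ | ⟨j₁, hj₁, he, hu, hI⟩
      · refine .inl ⟨he, fun k hk hk' => ?_⟩
        rcases (by omega : k = j ∨ k < j) with rfl | h
        · exact hn ⟨hk', fun h => h.1 he⟩
        · exact hI k h hk'
      · refine .inr ⟨j₁, hj₁, he, hu, fun k hk hk' => ?_⟩
        rcases (by omega : k = j ∨ k < j) with rfl | h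
        · by_contra h'
          rw [not_le] at h'
          exact hn ⟨hk', fun h => h.2 (by rwa [he])⟩
        · exact hI k h hk'
  · rintro s' - (⟨_, h⟩ | h)
    · obtain ⟨j, hj, hu⟩ := hu
      exact absurd hu (h j hj)
    · exact h

/-- Change the potential by the least slack. -/
def lapUpdate : Prog :=
  .seq (.rset 9 (.const 0) (.const 0) (rcell 8 (ivar 9)))
    (forLoop 4 (.succ (ivar 2))
      (.ite (.ieq (icell 7 (ivar 4)) (.const 0))
        (.rset 8 (ivar 4) (.const 0) (.sub (rcell 8 (ivar 4)) (rvar 9)))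
        (.rset 7 (ivar 4) (.const 0) (.sub (rcell 7 (ivar 4)) (rvar 9)))))

theorem lapUpdate_spec {s : State} {N : ℕ} (hN : s.ints 2 0 0 = N) (hN1 : 1 ≤ N) :
    Reaches lapUpdate s (400 * N) fun s' => ∀ j ≤ N,
      (s.ints 7 j 0 = 0 → s'.reals 7 j 0 = s.reals 7 j 0 ∧
        s'.reals 8 j 0 = s.reals 8 j 0 - s.reals 8 (s.ints 9 0 0) 0) ∧
      (s.ints 7 j 0 ≠ 0 →
        s'.reals 7 j 0 = s.reals 7 j 0 - s.reals 8 (s.ints 9 0 0) 0) := by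
  -- The least slack is saved first, because the loop may overwrite the very entry it comes from.
  set d := s.reals 8 (s.ints 9 0 0) 0 with hd
  refine (Reaches.seq (T₁ := 15) (T₂ := (N + 1) * (100 + 4 + 12) + (4 + 9))
    (R := fun s' => s'.reals 9 0 0 = d)
    (Reaches.of_wp (by simp [Prog.wp, IExp.eval, RExp.eval, setCell, hd]) (by decide)) ?_).mono
    (by omega) fun _ _ h => h
  intro s₁ hf₁ h9
  have hf₁i : s₁.ints = s.ints := funext fun k => hf₁.1 k (by simp [Prog.intWrites])
  -- There are `N + 1` iterations: the potential of the extra column `N`, which is scanned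
  -- throughout a search, must change as well.
  refine (Reaches.for_loop (fun j s' => (∀ k < j,
      (s.ints 7 k 0 = 0 → s'.reals 7 k 0 = s.reals 7 k 0 ∧
        s'.reals 8 k 0 = s.reals 8 k 0 - d) ∧
      (s.ints 7 k 0 ≠ 0 → s'.reals 7 k 0 = s.reals 7 k 0 - d)) ∧
      ∀ k, j ≤ k → s'.reals 7 k 0 = s.reals 7 k 0 ∧ s'.reals 8 k 0 = s.reals 8 k 0)
    (N + 1) 100 (fun s' hf => ?_) ?_ ?_).mono (by simp [IExp.cost]) ?_
  · simp only [IExp.eval, hf.1 2 (by decide), hf₁i, hN]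
  · simp [hf₁.2 7 (by decide), hf₁.2 8 (by decide)]
  · rintro j s' hj hf hk ⟨hI, hI'⟩
    have h7 : s'.ints 7 = s.ints 7 := by rw [hf.1 7 (by decide), hf₁i]
    have h9' : s'.reals 9 0 0 = d := by rw [hf.2 9 (by decide), h9]
    obtain ⟨hv, hm⟩ := hI' j le_rfl
    refine Reaches.of_wp ?_ (by decide)
    simp only [Prog.wp, IExp.eval, RExp.eval, BExp.Holds, hk, h7, h9', State.setVar_reals, hv, hm]
    refine ⟨fun hu => ⟨trivial, fun k hkj => ?_, fun k hkj => ?_⟩,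
      fun hu => ⟨trivial, fun k hkj => ?_, fun k hkj => ?_⟩⟩
    · by_cases h : k = j
      · simp [setCell, h, hu, hv]
      · simpa [setCell, h] using hI k (by omega)
    · have hne : k ≠ j := by omega
      simpa [setCell, hne] using hI' k (by omega)
    · by_cases h : k = j
      · simp [setCell, h, hu]
      · simpa [setCell, h] using hI k (by omega)
    · have hne : k ≠ j := by omega
      simpa [setCell, hne] using hI' k (by omega)
  · intro s' _ h j hj
    exact h.1 j (by omega)

/-- Scan one more column. -/
def lapScan : Prog :=
  .seq lapRelax (.seq lapPick (.seq lapUpdate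
    (.seq (.iset 8 (.const 0) (.const 0) (ivar 9)) (.iset 7 (ivar 9) (.const 0) (.const 1)))))

theorem lapScan_spec {s : State} {N r : ℕ} (hN : s.ints 2 0 0 = N) (hN1 : 1 ≤ N) (hr : r ≤ N)
    (h : Searching N r (s.reals 6) s) (hp : s.ints 5 (s.ints 8 0 0) 0 ≠ N) :
    Reaches lapScan s (900 * N) fun s' => Searching N r (s.reals 6) s' ∧
      unscanned N (s'.ivec 7) < unscanned N (s.ivec 7) := by
  obtain ⟨⟨rank, S⟩, H⟩ := h
  refine ((lapRelax_spec hN hN1).seq (T₂ := 200 * N + (400 * N + 20)) ?_).mono (by omega)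
    fun _ _ h => h
  intro s₁ hf₁ hR
  have hN₁ : s₁.ints 2 0 0 = N := by rw [hf₁.1 2 (by decide), hN]
  have hu₁ : s₁.ints 7 = s.ints 7 := hf₁.1 7 (by decide)
  refine (lapPick_spec hN₁ hN1 (by rw [hu₁]; exact S.exists_unused H hr hp)).seq ?_
  rintro s₂ hf₂ ⟨j₁, hj₁, h9, hu, hmin⟩
  have hN₂ : s₂.ints 2 0 0 = N := by rw [hf₂.1 2 (by decide), hN₁]
  have hm₂ : s₂.reals 8 = s₁.reals 8 := hf₂.2 8 (by decide)
  have hv₂ : s₂.reals 7 = s.reals 7 := by rw [hf₂.2 7 (by decide), hf₁.2 7 (by decide)]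
  have hu₂ : s₂.ints 7 = s.ints 7 := by rw [hf₂.1 7 (by decide), hu₁]
  rw [hu₁] at hu hmin
  refine (lapUpdate_spec hN₂ hN1).seq ?_
  intro s₃ hf₃ h₃
  rw [h9, hu₂, hm₂, hv₂] at h₃
  have h9' : s₃.ints 9 0 0 = j₁ := by rw [hf₃.1 9 (by decide), h9]
  have hu₃ : s₃.ints 7 = s.ints 7 := by rw [hf₃.1 7 (by decide), hu₂]
  have hp₃ : s₃.ints 5 = s.ints 5 := by
    rw [hf₃.1 5 (by decide), hf₂.1 5 (by decide), hf₁.1 5 (by decide)]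
  have hw₃ : s₃.ints 6 = s₁.ints 6 := by rw [hf₃.1 6 (by decide), hf₂.1 6 (by decide)]
  refine Reaches.of_wp ?_ (by decide)
  simp only [Prog.wp, IExp.eval, setCell_of_ne _ _ _ _ (by decide : (9 : ℕ) ≠ 8), h9']
  have hset : ∀ j, j ≠ j₁ → setCell (setCell s₃.ints 8 0 0 j₁) 7 j₁ 0 1 7 j 0 = s.ints 7 j 0 := by
    intro j hj
    simp [setCell, hj, hu₃]
  have hset₁ : setCell (setCell s₃.ints 8 0 0 j₁) 7 j₁ 0 1 7 j₁ 0 ≠ 0 := by simp [setCell]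
  refine ⟨?_, ?_⟩
  · obtain ⟨hS, hT⟩ := S.step (v' := s₃.rvec 7) (minv' := s₃.rvec 8)
      (used' := fun j => setCell (setCell s₃.ints 8 0 0 j₁) 7 j₁ 0 1 7 j 0)
      H hp hR hj₁ hu hmin (fun j hj h => (h₃ j hj).2 h) (fun j hj h => ((h₃ j hj).1 h).1)
      (fun j hj h => ((h₃ j hj.le).1 h).2) hset₁ hset
    have e5 : ({ s₃ with ints := setCell (setCell s₃.ints 8 0 0 j₁) 7 j₁ 0 1 } : State).ivec 5 =
        s.ivec 5 := State.ivec_congr (by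
      change setCell (setCell s₃.ints 8 0 0 j₁) 7 j₁ 0 1 5 = _
      rw [setCell_of_ne _ _ _ _ (by decide), setCell_of_ne _ _ _ _ (by decide), hp₃])
    have e6 : ({ s₃ with ints := setCell (setCell s₃.ints 8 0 0 j₁) 7 j₁ 0 1 } : State).ivec 6 =
        s₁.ivec 6 := State.ivec_congr (by
      change setCell (setCell s₃.ints 8 0 0 j₁) 7 j₁ 0 1 6 = _
      rw [setCell_of_ne _ _ _ _ (by decide), setCell_of_ne _ _ _ _ (by decide), hw₃])
    have e8 : setCell (setCell s₃.ints 8 0 0 j₁) 7 j₁ 0 1 8 0 0 = j₁ := by simp [setCell]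
    rw [Searching, e5, e6]
    simp only [e8]
    exact ⟨hS, hT⟩
  · have := unscanned_update hj₁ hu hset₁ hset
    change unscanned N (fun j => setCell (setCell s₃.ints 8 0 0 j₁) 7 j₁ 0 1 7 j 0) <
      unscanned N fun j => s.ints 7 j 0
    omega

/-- Search for a free column. -/
def lapSearch : Prog := .while (.neg (.ieq (icell 5 (ivar 8)) (ivar 2))) lapScan

theorem lapSearch_spec {s : State} {N r : ℕ} (hN : s.ints 2 0 0 = N) (hN1 : 1 ≤ N) (hr : r ≤ N)
    (h : Searching N r (s.reals 6) s) :
    Reaches lapSearch s (1000 * N ^ 2) fun s' => Searching N r (s.reals 6) s' ∧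
      s'.ints 5 (s'.ints 8 0 0) 0 = N := by
  refine (Reaches.while_loop (Searching N r (s.reals 6)) (fun s' => unscanned N (s'.ivec 7)) N
    (900 * N) h (unscanned_le _ _) ?_).mono ?_ ?_
  · intro s' hf hS hc
    have hN' : s'.ints 2 0 0 = N := by rw [hf.1 2 (by decide), hN]
    have hc' : s'.reals 6 = s.reals 6 := hf.2 6 (by decide)
    simp only [BExp.Holds, IExp.eval, hN'] at hc
    have := lapScan_spec hN' hN1 hr (hc' ▸ hS) hc
    rwa [hc'] at this
  · simp only [BExp.cost, IExp.cost]
    nlinarith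
  · rintro s' hf ⟨hS, hc⟩
    have hN' : s'.ints 2 0 0 = N := by rw [hf.1 2 (by decide), hN]
    simp only [BExp.Holds, IExp.eval, hN', not_not] at hc
    exact ⟨hS, hc⟩

/-- Augment the matching. -/
def lapAugment : Prog :=
  .while (.neg (.ieq (ivar 8) (ivar 2)))
    (.seq (.iset 9 (.const 0) (.const 0) (icell 6 (ivar 8)))
      (.seq (.iset 5 (ivar 8) (.const 0) (icell 5 (ivar 9)))
        (.iset 8 (.const 0) (.const 0) (ivar 9))))

theorem lapAugment_spec {s : State} {N r : ℕ} (hN : s.ints 2 0 0 = N) (hN1 : 1 ≤ N) (hr : r ≤ N)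
    (h : Searching N r (s.reals 6) s) (hp : s.ints 5 (s.ints 8 0 0) 0 = N) :
    Reaches lapAugment s (100 * N) fun s' => Tight N r N (s.reals 6) (s.rvec 7) (s'.ivec 5) := by
  obtain ⟨⟨rank, S⟩, H⟩ := h
  -- The rank of the hole is the variant; `rank_le` bounds its initial value, and so the length of
  -- the path, by `N`.
  refine (Reaches.while_loop (fun s' => Augment N r (s.reals 6) (s.rvec 7) (s.ivec 5) (s'.ivec 5)
    (s.ivec 6) (s.ivec 7) rank (s'.ints 8 0 0)) (fun s' => rank (s'.ints 8 0 0)) N 50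
    (S.augment H hr hp) ((Nat.le_add_right _ _).trans (S.rank_le _ S.le S.used_start)) ?_).mono
    ?_ ?_
  · intro s' hf hA hc
    have hN' : s'.ints 2 0 0 = N := by rw [hf.1 2 (by decide), hN]
    have h6 : s'.ints 6 = s.ints 6 := hf.1 6 (by decide)
    simp only [BExp.Holds, IExp.eval, hN'] at hc
    refine Reaches.of_wp ?_ (by decide)
    simp only [Prog.wp, IExp.eval]
    have := hA.step (p' := fun j => if j = s'.ints 8 0 0 then
      s'.ints 5 (s.ints 6 (s'.ints 8 0 0) 0) 0 else s'.ints 5 j 0) hc (by simp)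
      (fun j hj => by simp [hj])
    convert this using 2 <;> simp [setCell, h6, funext_iff]
  · simp only [BExp.cost, IExp.cost]
    omega
  · rintro s' hf ⟨hA, hc⟩
    have hN' : s'.ints 2 0 0 = N := by rw [hf.1 2 (by decide), hN]
    simp only [BExp.Holds, IExp.eval, hN', not_not] at hc
    have := hA.tight
    rwa [hc] at this

/-- Match one more row. -/
def lapRow : Prog := .seq lapInsert (.seq lapStart (.seq lapSearch lapAugment))

theorem lapRow_spec {s : State} {N r : ℕ} (hN : s.ints 2 0 0 = N) (hr : s.ints 3 0 0 = r)
    (hrN : r < N) (H : Tight N r N (s.reals 6) (s.rvec 7) (s.ivec 5)) :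
    Reaches lapRow s (1500 * N ^ 2) fun s' =>
      Tight N (r + 1) N (s.reals 6) (s'.rvec 7) (s'.ivec 5) := by
  have hN1 : 1 ≤ N := by omega
  refine ((lapInsert_spec hN hr hrN H).seq (T₂ := 200 * N + (1000 * N ^ 2 + 100 * N))
    ?_).mono (by nlinarith) fun _ _ h => h
  rintro s₁ hf₁ ⟨hp, H₁⟩
  have hN₁ : s₁.ints 2 0 0 = N := by rw [hf₁.1 2 (by decide), hN]
  have hr₁ : s₁.ints 3 0 0 = r := by rw [hf₁.1 3 (by decide), hr]
  have hc₁ : s₁.reals 6 = s.reals 6 := hf₁.2 6 (by decide)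
  rw [← hc₁] at H₁ ⊢
  refine (lapStart_spec hN₁ hr₁ hrN hp H₁).seq ?_
  intro s₂ hf₂ H₂
  have hN₂ : s₂.ints 2 0 0 = N := by rw [hf₂.1 2 (by decide), hN₁]
  have hc₂ : s₂.reals 6 = s₁.reals 6 := hf₂.2 6 (by decide)
  rw [← hc₂] at H₂ ⊢
  refine (lapSearch_spec hN₂ hN1 hrN H₂).seq ?_
  rintro s₃ hf₃ ⟨H₃, hp₃⟩
  have hN₃ : s₃.ints 2 0 0 = N := by rw [hf₃.1 2 (by decide), hN₂]
  have hc₃ : s₃.reals 6 = s₂.reals 6 := hf₃.2 6 (by decide)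
  rw [← hc₃] at H₃ ⊢
  refine (lapAugment_spec hN₃ hN1 hrN H₃ hp₃).mono le_rfl ?_
  intro s₄ hf₄ H₄
  have hv₄ : s₄.reals 7 = s₃.reals 7 := hf₄.2 7 (by decide)
  rwa [State.rvec_congr hv₄]

/-! ### Loops over matrices -/

/-- Run through the entries of a matrix of the size in the index variable `2`. -/
def grid (p : Prog) : Prog := forLoop 10 (ivar 2) (forLoop 11 (ivar 2) p)

/-- The body writes no index array, so an invariant of the real arrays suffices; `hrow` passes from
the end of a row to the start of the next. -/
theorem Reaches.grid {p : Prog} {s : State} {N : ℕ} (I : ℕ → ℕ → (ℕ → ℕ → ℕ → ℝ) → Prop)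
    (B : ℕ) (hN : s.ints 2 0 0 = N) (hN1 : 1 ≤ N) (hp : p.intWrites = []) (h0 : I 0 0 s.reals)
    (hrow : ∀ i r, I i N r → I (i + 1) 0 r)
    (step : ∀ i j s', i < N → j < N → Frame (grid p) s s' → s'.ints 10 0 0 = i →
      s'.ints 11 0 0 = j → I i j s'.reals → Reaches p s' B fun s'' => I i (j + 1) s''.reals) :
    Reaches (grid p) s ((B + 60) * N ^ 2) fun s' => I N 0 s'.reals := by
  have hw : (forLoop 11 (ivar 2) p).intWrites = [11, 11] := by
    simp [forLoop, Prog.intWrites, hp]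
  have hw' : (BAP.grid p).intWrites = [10, 11, 11, 10] := by
    rw [BAP.grid, forLoop]
    simp [Prog.intWrites, hw]
  have hsub : ∀ {s s' : State}, Frame (forLoop 11 (ivar 2) p) s s' → Frame (BAP.grid p) s s' :=
    fun h => h.mono (by rw [hw, hw']; decide)
      (by simp [BAP.grid, forLoop, Prog.realWrites])
  refine (Reaches.for_size (fun i s' => I i 0 s'.reals) (N * (B + 27)) hN hN1
    (by change 2 ∉ (BAP.grid p).intWrites; rw [hw']; decide) h0 ?_).mono (by nlinarith)
    fun _ _ h => h
  intro i s₁ hi hf₁ hk₁ hN₁ hI₁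
  refine (Reaches.for_size (fun j s' => I i j s'.reals) B hN₁ hN1 (by rw [hw]; decide) hI₁ ?_).mono
    le_rfl ?_
  · intro j s₂ hj hf₂ hk₂ hN₂ hI₂
    have hk : s₂.ints 10 0 0 = i := by rw [hf₂.1 10 (by rw [hw]; decide), hk₁]
    refine (step i j s₂ hi hj (Frame.trans hf₁ (hsub hf₂)) hk hk₂ hI₂).mono le_rfl ?_
    intro s₃ hf₃ hI₃
    exact ⟨by rw [hf₃.1 11 (by simp [hp]), hk₂], hI₃⟩
  · intro s₂ hf₂ hI₂
    exact ⟨by rw [hf₂.1 10 (by rw [hw]; decide), hk₁], hrow _ _ hI₂⟩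

/-- Set the leading block of the real array `k` to the matrix with the entries `e`, where the
indices are the variables `10` and `11`. -/
def fill (k : ℕ) (e : RExp) : Prog := grid (.rset k (ivar 10) (ivar 11) e)

theorem fill_intWrites (k : ℕ) (e : RExp) : (fill k e).intWrites = [10, 11, 11, 10] := rfl

theorem fill_realWrites (k : ℕ) (e : RExp) : (fill k e).realWrites = [k] := rfl

/-- The entries are evaluated while the array `k` is being overwritten, so `he` asks for their
values in every state of the frame; this is easy when `e` does not read `k`. -/
theorem fill_spec {k : ℕ} {e : RExp} {s : State} {N : ℕ} (A : Matrix (Fin N) (Fin N) ℝ)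
    (hN : s.ints 2 0 0 = N) (hN1 : 1 ≤ N) (hcost : e.cost ≤ 30)
    (he : ∀ (i j : Fin N) (s' : State), Frame (fill k e) s s' → s'.ints 10 0 0 = i →
      s'.ints 11 0 0 = j → e.eval s' = A i j) :
    Reaches (fill k e) s (100 * N ^ 2) fun s' => s'.matrix k N = A := by
  refine (Reaches.grid (fun i j r => ∀ i' j' : Fin N, (i' : ℕ) < i ∨ (i' : ℕ) = i ∧ (j' : ℕ) < j →
    r k i' j' = A i' j') 40 hN hN1 rfl (fun i' j' h => by omega) ?_ ?_).mono (by omega) ?_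
  · intro i r h i' j' hij
    exact h i' j' (by omega)
  · intro i j s' hi hj hf hi' hj' hI
    refine Reaches.of_wp ?_ (by simp only [Prog.timeBound, IExp.cost]; omega)
    simp only [Prog.wp, IExp.eval, hi', hj']
    intro i₁ j₁ h
    by_cases h' : (i₁ : ℕ) = i ∧ (j₁ : ℕ) = j
    · rw [← he i₁ j₁ s' hf (by omega) (by omega)]
      simp [setCell, h']
    · simp only [setCell, h', and_false, if_false]
      exact hI i₁ j₁ (by omega)
  · intro s' _ h
    ext i j
    exact h i j (.inl i.2)

/-- Store the inner product of the real arrays `u` and `w` in the real variable `k`. -/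
def dot (k u w : ℕ) : Prog :=
  .seq (.rset k (.const 0) (.const 0) .zero)
    (grid (.rset k (.const 0) (.const 0) (.add (rvar k)
      (.mul (.get u (ivar 10) (ivar 11)) (.get w (ivar 10) (ivar 11))))))

theorem dot_intWrites (k u w : ℕ) : (dot k u w).intWrites = [10, 11, 11, 10] := rfl

theorem dot_realWrites (k u w : ℕ) : (dot k u w).realWrites = [k, k] := rfl

theorem dot_spec {k u w : ℕ} {s : State} {N : ℕ} (hN : s.ints 2 0 0 = N) (hN1 : 1 ≤ N)
    (hu : u ≠ k) (hw : w ≠ k) :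
    Reaches (dot k u w) s (200 * N ^ 2) fun s' =>
      s'.reals k 0 0 = linCost (s.matrix u N) (s.matrix w N) := by
  have hN2 : 1 ≤ N ^ 2 := Nat.one_le_pow _ _ hN1
  refine (Reaches.seq (T₁ := 10) (T₂ := (40 + 60) * N ^ 2) (R := fun s' => s'.reals k 0 0 = 0)
    (Reaches.of_wp (by simp [Prog.wp, IExp.eval, RExp.eval, setCell])
      (by simp [Prog.timeBound, IExp.cost, RExp.cost])) ?_).mono (by omega) fun _ _ h => h
  intro s₁ hf₁ h₁
  have hN₁ : s₁.ints 2 0 0 = N := by rw [hf₁.1 2 (by simp [Prog.intWrites]), hN]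
  refine (Reaches.grid (fun i j r => r k 0 0 =
    ∑ i' ∈ Finset.range i, ∑ j' ∈ Finset.range N, s.reals u i' j' * s.reals w i' j' +
      ∑ j' ∈ Finset.range j, s.reals u i j' * s.reals w i j') 40 hN₁ hN1 rfl (by simp [h₁])
    ?_ ?_).mono le_rfl ?_
  · intro i r h
    rw [h, Finset.sum_range_succ]
    simp
  · intro i j s' hi hj hf hi' hj' hI
    have hu' : s'.reals u = s.reals u := by
      rw [hf.2 u (by simpa [BAP.grid, forLoop, Prog.realWrites] using hu),
        hf₁.2 u (by simpa [Prog.realWrites] using hu)]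
    have hw' : s'.reals w = s.reals w := by
      rw [hf.2 w (by simpa [BAP.grid, forLoop, Prog.realWrites] using hw),
        hf₁.2 w (by simpa [Prog.realWrites] using hw)]
    refine Reaches.of_wp ?_ (by simp [Prog.timeBound, IExp.cost, RExp.cost])
    simp only [Prog.wp, IExp.eval, RExp.eval, hi', hj', hu', hw', setCell, and_self, if_true]
    rw [hI, Finset.sum_range_succ _ j]
    ring
  · intro s' _ h
    rw [h, linCost]
    simp only [Finset.range_zero, Finset.sum_empty, add_zero, Finset.sum_range, State.matrix]

/-! ### Optimality of the final matching -/

/-- A tight perfect matching is an optimal solution of the linear assignment problem. -/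
theorem Tight.isLAPMin {N : ℕ} {c : ℕ → ℕ → ℝ} {v : ℕ → ℝ} {p : ℕ → ℕ} (H : Tight N N N c v p)
    {A x : Matrix (Fin N) (Fin N) ℝ} (hA : ∀ i j, A i j = c i j)
    (hx : ∀ i j, x i j = if p j = i then 1 else 0) : IsLAPMin A x := by
  have hg : ∀ i : Fin N, ∃ j : Fin N, p j = i := fun i => by
    obtain ⟨j, hj, hjN, he⟩ := H.surj i i.2
    exact ⟨⟨j, by omega⟩, he⟩
  choose g hg using hg
  have hinj : Function.Injective g := fun i i' h => by
    apply Fin.ext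
    rw [← hg i, ← hg i', h]
  have hbij : Function.Bijective g := Finite.injective_iff_bijective.1 hinj
  have hpg : ∀ i j : Fin N, p j = i ↔ j = g i := fun i j => by
    constructor
    · intro h
      obtain ⟨i', rfl⟩ := hbij.2 j
      rw [hg i'] at h
      rw [Fin.ext h]
    · rintro rfl
      exact hg i
  have hx' : ∀ i j, x i j = if j = g i then 1 else 0 := fun i j => by
    rw [hx]
    simp only [hpg]
  have hmin : ∀ i j : Fin N, A i (g i) - v (g i) ≤ A i j - v j := fun i j => by
    have := H.slack_nonneg (g i) (g i).2.le (g i).2.ne (by rw [hg]; exact i.2.ne) j j.2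
    rw [slack, hg] at this
    rw [hA, hA]
    linarith
  have hcost : linCost A x = ∑ i, A i (g i) := by simp [linCost, hx']
  refine ⟨⟨fun i j => ?_, fun i => ?_, fun j => ?_⟩, fun x' hx₁ => ?_⟩
  · rw [hx']
    split_ifs <;> simp
  · simp [hx']
  · obtain ⟨i, rfl⟩ := hbij.2 j
    simp [hx', hinj.eq_iff]
  -- Column sums equal to `1` make the potential contribute the constant `∑ v` to every assignment;
  -- row sums equal to `1` then let the reduced costs be compared row by row.
  · have h1 : linCost A x' = ∑ i, ∑ j, (A i j - v j) * x' i j + ∑ j : Fin N, v j := by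
      have : ∑ j : Fin N, v j = ∑ i, ∑ j : Fin N, v j * x' i j := by
        rw [Finset.sum_comm]
        refine Finset.sum_congr rfl fun j _ => ?_
        rw [← Finset.mul_sum, hx₁.2.2, mul_one]
      rw [this, linCost, ← Finset.sum_add_distrib]
      refine Finset.sum_congr rfl fun i _ => ?_
      rw [← Finset.sum_add_distrib]
      exact Finset.sum_congr rfl fun j _ => by ring
    have h2 : ∑ i, (A i (g i) - v (g i)) ≤ ∑ i, ∑ j, (A i j - v j) * x' i j := by
      refine Finset.sum_le_sum fun i _ => ?_
      calc A i (g i) - v (g i) = ∑ j, (A i (g i) - v (g i)) * x' i j := by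
            rw [← Finset.mul_sum, hx₁.2.1, mul_one]
        _ ≤ _ := Finset.sum_le_sum fun j _ => by
            refine mul_le_mul_of_nonneg_right (hmin i j) ?_
            rcases hx₁.1 i j with h | h <;> simp [h]
    have h3 : ∑ i, v (g i) = ∑ j : Fin N, v j := hbij.sum_comp fun j : Fin N => v j
    rw [Finset.sum_sub_distrib] at h2
    rw [hcost, h1]
    linarith

/-- Store the permutation matrix of the matching. -/
def lapOutput : Prog :=
  grid (.ite (.ieq (icell 5 (ivar 11)) (ivar 10)) (.rset 10 (ivar 10) (ivar 11) .one)
    (.rset 10 (ivar 10) (ivar 11) .zero))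

theorem lapOutput_spec {s : State} {N : ℕ} (hN : s.ints 2 0 0 = N) (hN1 : 1 ≤ N) :
    Reaches lapOutput s (200 * N ^ 2) fun s' =>
      ∀ i j, s'.matrix 10 N i j = if s.ivec 5 j = i then 1 else 0 := by
  refine (Reaches.grid (fun i j r => ∀ i' j', j' < N → i' < i ∨ i' = i ∧ j' < j →
    r 10 i' j' = if s.ivec 5 j' = i' then 1 else 0) 140 hN hN1 rfl
    (fun i' j' _ h => by omega) ?_ ?_).mono (by omega) ?_
  · intro i r h i' j' hj hij
    exact h i' j' hj (by omega)
  · intro i j s' hi hj hf hi' hj' hI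
    have h5 : s'.ints 5 = s.ints 5 := hf.1 5 (by decide)
    refine Reaches.of_wp ?_ (by decide)
    simp only [Prog.wp, IExp.eval, RExp.eval, BExp.Holds, hi', hj', h5]
    refine ⟨fun hc i₁ j₁ hj₁ h => ?_, fun hc i₁ j₁ hj₁ h => ?_⟩
    all_goals
      by_cases h' : i₁ = i ∧ j₁ = j
      · simp [setCell, h', hc]
      · simp only [setCell, h', and_false, if_false]
        exact hI i₁ j₁ hj₁ (by omega)
  · intro s' _ h i j
    exact h i j j.2 (.inl i.2)

/-- Solve the linear assignment problem with the costs in the real array `6`. -/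
def lap : Prog := .seq lapInit (.seq (forLoop 3 (ivar 2) lapRow) lapOutput)

theorem lap_spec {s : State} {N : ℕ} (hN : s.ints 2 0 0 = N) (hN1 : 1 ≤ N) :
    Reaches lap s (2000 * N ^ 3) fun s' => IsLAPMin (s.matrix 6 N) (s'.matrix 10 N) := by
  have hN2 : N ≤ N ^ 2 := Nat.le_self_pow (by norm_num) N
  have hN3 : N ^ 2 ≤ N ^ 3 := Nat.pow_le_pow_right hN1 (by norm_num)
  refine ((lapInit_spec hN hN1).seq (T₂ := N * (1500 * N ^ 2 + 27) + 200 * N ^ 2) ?_).mono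
    (by nlinarith) fun _ _ h => h
  intro s₁ hf₁ h₁
  have hN₁ : s₁.ints 2 0 0 = N := by rw [hf₁.1 2 (by decide), hN]
  have hc₁ : s₁.reals 6 = s.reals 6 := hf₁.2 6 (by decide)
  -- The potential needs no initialization: the empty matching is tight for whatever an earlier call
  -- has left in the array `7`.
  refine (Reaches.for_size (fun r s' => Tight N r N (s.reals 6) (s'.rvec 7) (s'.ivec 5))
    (1500 * N ^ 2) hN₁ hN1 (by decide) (Tight.init fun j hj => ?_) ?_).seq ?_
  · rw [State.ivec_apply, State.setVar_of_ne _ _ (by decide), h₁ j hj]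
  · intro r s₂ hr hf₂ hk hN₂ H
    have hc₂ : s₂.reals 6 = s.reals 6 := by rw [hf₂.2 6 (by decide), hc₁]
    rw [← hc₂] at H ⊢
    refine (lapRow_spec hN₂ hk hr H).mono le_rfl fun s₃ hf₃ H₃ => ?_
    refine ⟨by rw [hf₃.1 3 (by decide), hk], ?_⟩
    have h5 : (s₃.setVar 3 (r + 1)).ints 5 = s₃.ints 5 := State.setVar_of_ne _ _ (by decide)
    rw [State.ivec_congr h5]
    exact H₃
  · intro s₂ hf₂ H
    have hN₂ : s₂.ints 2 0 0 = N := by rw [hf₂.1 2 (by decide), hN₁]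
    exact (lapOutput_spec hN₂ hN1).mono le_rfl fun s₃ _ h₃ => H.isLAPMin (fun _ _ => rfl) h₃

/-- Solve the linear assignment problem with the costs `e`. -/
def solve (e : RExp) : Prog := .seq (fill 6 e) lap

theorem solve_spec {e : RExp} {s : State} {N : ℕ} (A : Matrix (Fin N) (Fin N) ℝ)
    (hN : s.ints 2 0 0 = N) (hN1 : 1 ≤ N) (hcost : e.cost ≤ 30)
    (he : ∀ (i j : Fin N) (s' : State), Frame (fill 6 e) s s' → s'.ints 10 0 0 = i →
      s'.ints 11 0 0 = j → e.eval s' = A i j) :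
    Reaches (solve e) s (2100 * N ^ 3) fun s' =>
      s'.matrix 6 N = A ∧ IsLAPMin A (s'.matrix 10 N) := by
  have hN3 : N ^ 2 ≤ N ^ 3 := Nat.pow_le_pow_right hN1 (by norm_num)
  refine ((fill_spec A hN hN1 hcost he).seq (T₂ := 2000 * N ^ 3) ?_).mono (by omega)
    fun _ _ h => h
  intro s₁ hf₁ h₁
  have hN₁ : s₁.ints 2 0 0 = N := by rw [hf₁.1 2 (by rw [fill_intWrites]; decide), hN]
  refine (lap_spec hN₁ hN1).mono le_rfl fun s₂ hf₂ h₂ => ?_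
  have h6 : s₂.matrix 6 N = s₁.matrix 6 N := by
    funext i j
    rw [State.matrix, State.matrix, hf₂.2 6 (by decide)]
  rw [h₁] at h₂ h6
  exact ⟨h6, h₂⟩

/-! ### Candidates for the optimal solution -/

/-- The objective function in terms of the factored form. -/
def productCost {m n : ℕ} (a : Matrix (Fin m) (Fin m) ℝ) (b : Matrix (Fin n) (Fin n) ℝ)
    (C : Matrix (Fin m) (Fin m) ℝ) (D : Matrix (Fin n) (Fin n) ℝ)
    (x : Matrix (Fin m) (Fin m) ℝ) (y : Matrix (Fin n) (Fin n) ℝ) : ℝ :=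
  linCost a x * linCost b y + linCost C x + linCost D y

theorem productCost_swap {m n : ℕ} (a : Matrix (Fin m) (Fin m) ℝ) (b : Matrix (Fin n) (Fin n) ℝ)
    (C : Matrix (Fin m) (Fin m) ℝ) (D : Matrix (Fin n) (Fin n) ℝ)
    (x : Matrix (Fin m) (Fin m) ℝ) (y : Matrix (Fin n) (Fin n) ℝ) :
    productCost b a D C y x = productCost a b C D x y := by
  simp only [productCost]
  ring

theorem objective_eq_productCost {m n : ℕ} {Q : Fin m → Fin m → Fin n → Fin n → ℝ}
    {a : Matrix (Fin m) (Fin m) ℝ} {b : Matrix (Fin n) (Fin n) ℝ} (hQ : IsFactoredForm Q a b)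
    (C : Matrix (Fin m) (Fin m) ℝ) (D : Matrix (Fin n) (Fin n) ℝ)
    (x : Matrix (Fin m) (Fin m) ℝ) (y : Matrix (Fin n) (Fin n) ℝ) :
    objective Q C D x y = productCost a b C D x y := by
  simp only [objective, productCost, linCost, Finset.sum_mul, add_left_inj]
  refine Finset.sum_congr rfl fun i _ => Finset.sum_congr rfl fun j _ => ?_
  simp only [Finset.mul_sum]
  refine Finset.sum_congr rfl fun k _ => Finset.sum_congr rfl fun l _ => ?_
  rw [hQ]
  ring

theorem linCost_smul_add {m : ℕ} (t : ℝ) (a C x : Matrix (Fin m) (Fin m) ℝ) :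
    linCost (t • a + C) x = t * linCost a x + linCost C x := by
  simp only [linCost, Matrix.add_apply, Matrix.smul_apply, smul_eq_mul, add_mul,
    Finset.sum_add_distrib, Finset.mul_sum, mul_assoc]

theorem linCost_neg {m : ℕ} (a x : Matrix (Fin m) (Fin m) ℝ) :
    linCost (-a) x = -linCost a x := by
  simp [linCost]

theorem isLAPMin_neg {m : ℕ} {a x : Matrix (Fin m) (Fin m) ℝ} :
    IsLAPMin (-a) x ↔ IsLAPMax a x := by
  simp [IsLAPMin, IsLAPMax, linCost_neg]

/-- All assignments have the same cost for a sum matrix. -/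
theorem IsSumMatrix.linCost_eq {m : ℕ} {A x x' : Matrix (Fin m) (Fin m) ℝ} (hA : IsSumMatrix A)
    (hx : IsAssignment x) (hx' : IsAssignment x') : linCost A x = linCost A x' := by
  obtain ⟨r, s, h⟩ := hA
  have key : ∀ z, IsAssignment z → linCost A z = ∑ i, r i + ∑ j, s j := fun z hz => by
    simp only [linCost, h, add_mul, Finset.sum_add_distrib]
    congr 1
    · simp [← Finset.mul_sum, hz.2.1]
    · rw [Finset.sum_comm]
      simp [← Finset.mul_sum, hz.2.2]
  rw [key x hx, key x' hx']

/-- If `D` is a sum matrix, every pair of assignments is at least as expensive as one of the two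
candidates. -/
theorem productCost_le_or_le {m n : ℕ} {a C x₁ x₂ x : Matrix (Fin m) (Fin m) ℝ}
    {b D y₁ y₂ y : Matrix (Fin n) (Fin n) ℝ} (hD : IsSumMatrix D)
    (hy₁ : IsLAPMin b y₁) (hy₂ : IsLAPMax b y₂)
    (hx₁ : IsLAPMin (linCost b y₁ • a + C) x₁) (hx₂ : IsLAPMin (linCost b y₂ • a + C) x₂)
    (hx : IsAssignment x) (hy : IsAssignment y) :
    productCost a b C D x₁ y₁ ≤ productCost a b C D x y ∨
      productCost a b C D x₂ y₂ ≤ productCost a b C D x y := by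
  have h1 := hx₁.2 x hx
  have h2 := hx₂.2 x hx
  have h3 := hy₁.2 y hy
  have h4 := hy₂.2 y hy
  have h5 := hD.linCost_eq hy₁.1 hy
  have h6 := hD.linCost_eq hy₂.1 hy
  simp only [linCost_smul_add] at h1 h2
  simp only [productCost]
  -- The sign of `a·x` decides which extreme value of `b·y` is the better partner for `x`.
  rcases le_total 0 (linCost a x) with h | h
  · left
    have := mul_le_mul_of_nonneg_left h3 h
    linarith
  · right
    have := mul_le_mul_of_nonpos_left h4 h
    linarith

/-! ### A program for the bilinear assignment problem -/

/-- The entry of the real array `k` at the indices in the variables `10` and `11`. -/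
abbrev entry (k : ℕ) : RExp := .get k (ivar 10) (ivar 11)

/-- Choose the index variable `k` as the current size. -/
def loadSize (k : ℕ) : Prog := .iset 2 (.const 0) (.const 0) (ivar k)

theorem loadSize_spec {s : State} {k N : ℕ} (h : s.ints k 0 0 = N) :
    Reaches (loadSize k) s 10 fun s' => s'.ints 2 0 0 = N ∧ s'.reals = s.reals :=
  Reaches.of_wp (by simp [loadSize, Prog.wp, IExp.eval, setCell, h])
    (by simp [loadSize, Prog.timeBound, IExp.cost])

/-- Compute a candidate: an assignment of minimum or maximum cost for the array `kb`, stored in the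
array `12`, an optimal assignment for the resulting costs, stored in the array `10`, and the value
of the objective function, stored in the variable `14`. -/
def compute (neg : Bool) (ka kb kC kD km kn : ℕ) : Prog :=
  .seq (loadSize kn)
    (.seq (solve (if neg then .sub .zero (entry kb) else entry kb))
      (.seq (fill 12 (entry 10))
        (.seq (dot 13 kb 12)
          (.seq (loadSize km)
            (.seq (solve (.add (.mul (rvar 13) (entry ka)) (entry kC)))
              (.seq (dot 14 6 10)
                (.seq (loadSize kn)
                  (.seq (dot 13 kD 12)
                    (.rset 14 (.const 0) (.const 0) (.add (rvar 14) (rvar 13)))))))))))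

/-- The index variables `km`, `kn` and the real arrays `ka`, `kb`, `kC`, `kD` hold an instance. -/
structure Loaded {m n : ℕ} (a : Matrix (Fin m) (Fin m) ℝ) (b : Matrix (Fin n) (Fin n) ℝ)
    (C : Matrix (Fin m) (Fin m) ℝ) (D : Matrix (Fin n) (Fin n) ℝ) (ka kb kC kD km kn : ℕ)
    (s : State) : Prop where
  m_eq : s.ints km 0 0 = m
  n_eq : s.ints kn 0 0 = n
  a_eq : s.matrix ka m = a
  b_eq : s.matrix kb n = b
  C_eq : s.matrix kC m = C
  D_eq : s.matrix kD n = D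

theorem Loaded.swap {m n : ℕ} {a C : Matrix (Fin m) (Fin m) ℝ} {b D : Matrix (Fin n) (Fin n) ℝ}
    {ka kb kC kD km kn : ℕ} {s : State} (h : Loaded a b C D ka kb kC kD km kn s) :
    Loaded b a D C kb ka kD kC kn km s :=
  ⟨h.n_eq, h.m_eq, h.b_eq, h.a_eq, h.D_eq, h.C_eq⟩

/-- The arrays with the input are the same in both states. -/
def SameInput (s s' : State) : Prop :=
  (∀ k < 2, s'.ints k = s.ints k) ∧ ∀ k < 4, s'.reals k = s.reals k

theorem SameInput.trans {s s₁ s₂ : State} (h : SameInput s s₁) (h' : SameInput s₁ s₂) :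
    SameInput s s₂ :=
  ⟨fun k hk => (h'.1 k hk).trans (h.1 k hk), fun k hk => (h'.2 k hk).trans (h.2 k hk)⟩

theorem State.matrix_congr {s s' : State} {k : ℕ} (m : ℕ) (h : s'.reals k = s.reals k) :
    s'.matrix k m = s.matrix k m := by
  funext i j
  rw [State.matrix, State.matrix, h]

theorem Loaded.congr {m n : ℕ} {a C : Matrix (Fin m) (Fin m) ℝ} {b D : Matrix (Fin n) (Fin n) ℝ}
    {ka kb kC kD km kn : ℕ} {s s' : State} (h : Loaded a b C D ka kb kC kD km kn s)
    (hs : SameInput s s') (ha : ka < 4) (hb : kb < 4) (hC : kC < 4) (hD : kD < 4) (hm : km < 2)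
    (hn : kn < 2) : Loaded a b C D ka kb kC kD km kn s' :=
  ⟨by rw [hs.1 _ hm, h.m_eq], by rw [hs.1 _ hn, h.n_eq],
    by rw [State.matrix_congr _ (hs.2 _ ha), h.a_eq],
    by rw [State.matrix_congr _ (hs.2 _ hb), h.b_eq],
    by rw [State.matrix_congr _ (hs.2 _ hC), h.C_eq],
    by rw [State.matrix_congr _ (hs.2 _ hD), h.D_eq]⟩

theorem Frame.sameInput {p : Prog} {s s' : State} (h : Frame p s s')
    (hi : ∀ k ∈ p.intWrites, 2 ≤ k) (hr : ∀ k ∈ p.realWrites, 4 ≤ k) : SameInput s s' :=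
  ⟨fun k hk => h.1 k fun h' => by have := hi k h'; omega,
    fun k hk => h.2 k fun h' => by have := hr k h'; omega⟩

/-- The written arrays do not depend on the cost expression; replacing it by `.zero` gives a closed
list on which `decide` works. -/
theorem solve_intWrites (e : RExp) : (solve e).intWrites = (solve .zero).intWrites := rfl

theorem solve_realWrites (e : RExp) : (solve e).realWrites = (solve .zero).realWrites := rfl

theorem solve_sameInput {e : RExp} {s s' : State} (h : Frame (solve e) s s') : SameInput s s' :=
  h.sameInput (by rw [solve_intWrites]; decide) (by rw [solve_realWrites]; decide)

theorem fill_sameInput {k : ℕ} {e : RExp} {s s' : State} (h : Frame (fill k e) s s')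
    (hk : 4 ≤ k) : SameInput s s' :=
  h.sameInput (by rw [fill_intWrites]; decide) (by simpa [fill_realWrites] using hk)

theorem dot_sameInput {k u w : ℕ} {s s' : State} (h : Frame (dot k u w) s s')
    (hk : 4 ≤ k) : SameInput s s' :=
  h.sameInput (by rw [dot_intWrites]; decide) (by simpa [dot_realWrites] using hk)

theorem loadSize_sameInput {k : ℕ} {s s' : State} (h : Frame (loadSize k) s s') :
    SameInput s s' :=
  h.sameInput (by simp [loadSize, Prog.intWrites]) (by simp [loadSize, Prog.realWrites])

/-- The array numbers are parameters so that the same text serves both roles of the two matrices.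
The array `15` is tracked because it holds the best value found earlier. -/
theorem compute_spec {m n : ℕ} {a C : Matrix (Fin m) (Fin m) ℝ} {b D : Matrix (Fin n) (Fin n) ℝ}
    {ka kb kC kD km kn : ℕ} {s : State} (neg : Bool) (h : Loaded a b C D ka kb kC kD km kn s)
    (hm1 : 1 ≤ m) (hn1 : 1 ≤ n)
    (ha : ka < 4) (hb : kb < 4) (hC : kC < 4) (hD : kD < 4) (hm : km < 2) (hn : kn < 2) :
    Reaches (compute neg ka kb kC kD km kn) s (3000 * (m ^ 3 + n ^ 3)) fun s' =>
      SameInput s s' ∧ s'.ints 2 0 0 = n ∧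
      IsLAPMin (if neg then -b else b) (s'.matrix 12 n) ∧
      IsLAPMin (linCost b (s'.matrix 12 n) • a + C) (s'.matrix 10 m) ∧
      s'.reals 14 0 0 = productCost a b C D (s'.matrix 10 m) (s'.matrix 12 n) ∧
      s'.reals 15 = s.reals 15 := by
  have hm2 : m ^ 2 ≤ m ^ 3 := Nat.pow_le_pow_right hm1 (by norm_num)
  have hn2 : n ^ 2 ≤ n ^ 3 := Nat.pow_le_pow_right hn1 (by norm_num)
  have hm0 : 1 ≤ m ^ 2 := Nat.one_le_pow _ _ hm1
  have hn0 : 1 ≤ n ^ 2 := Nat.one_le_pow _ _ hn1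
  refine ((loadSize_spec h.n_eq).seq (T₂ := 2100 * n ^ 3 + (100 * n ^ 2 + (200 * n ^ 2 + (10 +
    (2100 * m ^ 3 + (200 * m ^ 2 + (10 + (200 * n ^ 2 + 20)))))))) ?_).mono (by omega)
    fun _ _ h => h
  rintro s₁ hf₁ ⟨hN₁, hr₁⟩
  have K₁ := loadSize_sameInput hf₁
  have L₁ := h.congr K₁ ha hb hC hD hm hn
  refine (solve_spec (if neg then -b else b) hN₁ hn1 ?_ ?_).seq ?_
  · cases neg <;> simp [RExp.cost, IExp.cost]
  · intro i j s' hf hi hj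
    have L := L₁.congr (fill_sameInput hf (by norm_num)) ha hb hC hD hm hn
    have := congr_fun (congr_fun L.b_eq i) j
    cases neg <;> simp [RExp.eval, IExp.eval, hi, hj, ← this, State.matrix]
  rintro s₂ hf₂ ⟨-, h₂⟩
  have K₂ := K₁.trans (solve_sameInput hf₂)
  have hN₂ : s₂.ints 2 0 0 = n := by rw [hf₂.1 2 (by rw [solve_intWrites]; decide), hN₁]
  have hb₂ : s₂.reals 15 = s.reals 15 := by
    rw [hf₂.2 15 (by rw [solve_realWrites]; decide), hr₁]
  refine (fill_spec (s₂.matrix 10 n) hN₂ hn1 (by simp [RExp.cost, IExp.cost]) ?_).seq ?_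
  · intro i j s' hf hi hj
    simp [RExp.eval, IExp.eval, hi, hj, State.matrix,
      hf.2 10 (by rw [fill_realWrites]; decide)]
  intro s₃ hf₃ h₃
  have K₃ := K₂.trans (fill_sameInput hf₃ (by norm_num))
  have L₃ := h.congr K₃ ha hb hC hD hm hn
  have hN₃ : s₃.ints 2 0 0 = n := by rw [hf₃.1 2 (by rw [fill_intWrites]; decide), hN₂]
  refine (dot_spec hN₃ hn1 (by omega) (by norm_num)).seq ?_
  intro s₄ hf₄ h₄
  rw [L₃.b_eq] at h₄
  have K₄ := K₃.trans (dot_sameInput hf₄ (by norm_num))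
  have L₄ := h.congr K₄ ha hb hC hD hm hn
  have hY₄ : s₄.matrix 12 n = s₃.matrix 12 n :=
    State.matrix_congr _ (hf₄.2 12 (by rw [dot_realWrites]; decide))
  refine (loadSize_spec L₄.m_eq).seq ?_
  rintro s₅ hf₅ ⟨hN₅, hr₅⟩
  have K₅ := K₄.trans (loadSize_sameInput hf₅)
  have L₅ := h.congr K₅ ha hb hC hD hm hn
  refine (solve_spec (linCost b (s₃.matrix 12 n) • a + C) hN₅ hm1
    (by simp [RExp.cost, IExp.cost]) ?_).seq ?_
  · intro i j s' hf hi hj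
    have L := L₅.congr (fill_sameInput hf (by norm_num)) ha hb hC hD hm hn
    have ea := congr_fun (congr_fun L.a_eq i) j
    have eC := congr_fun (congr_fun L.C_eq i) j
    have e13 : s'.reals 13 0 0 = linCost b (s₃.matrix 12 n) := by
      rw [hf.2 13 (by rw [fill_realWrites]; decide), hr₅, h₄]
    simp [RExp.eval, IExp.eval, hi, hj, ← ea, ← eC, State.matrix, e13]
  rintro s₆ hf₆ ⟨h₆, hX⟩
  have K₆ := K₅.trans (solve_sameInput hf₆)
  have hN₆ : s₆.ints 2 0 0 = m := by rw [hf₆.1 2 (by rw [solve_intWrites]; decide), hN₅]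
  -- The array `6` still holds the costs `(b·y) a + C`, so its inner product with `x` gives all of
  -- the objective except `D·y`.
  refine (dot_spec hN₆ hm1 (by norm_num) (by norm_num)).seq ?_
  intro s₇ hf₇ h₇
  have K₇ := K₆.trans (dot_sameInput hf₇ (by norm_num))
  have L₇ := h.congr K₇ ha hb hC hD hm hn
  refine (loadSize_spec L₇.n_eq).seq ?_
  rintro s₈ hf₈ ⟨hN₈, hr₈⟩
  have K₈ := K₇.trans (loadSize_sameInput hf₈)
  have L₈ := h.congr K₈ ha hb hC hD hm hn
  refine (dot_spec hN₈ hn1 (by omega) (by norm_num)).seq ?_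
  intro s₉ hf₉ h₉
  have K₉ := K₈.trans (dot_sameInput hf₉ (by norm_num))
  have e10 : s₉.reals 10 = s₆.reals 10 := by
    rw [hf₉.2 10 (by rw [dot_realWrites]; decide), hr₈,
      hf₇.2 10 (by rw [dot_realWrites]; decide)]
  have e12 : s₈.reals 12 = s₃.reals 12 := by
    rw [hr₈, hf₇.2 12 (by rw [dot_realWrites]; decide),
      hf₆.2 12 (by rw [solve_realWrites]; decide), hr₅, hf₄.2 12 (by rw [dot_realWrites]; decide)]
  have e12' : s₉.reals 12 = s₃.reals 12 := by
    rw [hf₉.2 12 (by rw [dot_realWrites]; decide), e12]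
  have e14 : s₉.reals 14 0 0 = linCost (s₆.matrix 6 m) (s₆.matrix 10 m) := by
    rw [hf₉.2 14 (by rw [dot_realWrites]; decide), hr₈, h₇]
  have e15 : s₉.reals 15 = s.reals 15 := by
    rw [hf₉.2 15 (by rw [dot_realWrites]; decide), hr₈,
      hf₇.2 15 (by rw [dot_realWrites]; decide), hf₆.2 15 (by rw [solve_realWrites]; decide), hr₅,
      hf₄.2 15 (by rw [dot_realWrites]; decide), hf₃.2 15 (by rw [fill_realWrites]; decide), hb₂]
  have hN₉ : s₉.ints 2 0 0 = n := by rw [hf₉.1 2 (by rw [dot_intWrites]; decide), hN₈]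
  rw [L₈.D_eq, State.matrix_congr n e12] at h₉
  rw [h₆, linCost_smul_add] at e14
  refine (Reaches.of_wp (Q := fun s' => s'.ints = s₉.ints ∧
    (∀ k, k ≠ 14 → s'.reals k = s₉.reals k) ∧
    s'.reals 14 0 0 = s₉.reals 14 0 0 + s₉.reals 13 0 0) (by
      exact ⟨rfl, fun k hk => setCell_of_ne _ _ _ _ hk,
        by simp [setCell, RExp.eval, IExp.eval]⟩) (by decide)).mono le_rfl ?_
  rintro s' - ⟨hi, hr, hv⟩
  have eX : s'.matrix 10 m = s₆.matrix 10 m :=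
    State.matrix_congr _ (by rw [hr 10 (by decide), e10])
  have eY : s'.matrix 12 n = s₃.matrix 12 n :=
    State.matrix_congr _ (by rw [hr 12 (by decide), e12'])
  rw [eX, eY]
  refine ⟨K₉.trans ⟨fun k _ => by rw [hi], fun k hk => hr k (by omega)⟩, by rw [hi, hN₉],
    h₃ ▸ h₂, hX, ?_, by rw [hr 15 (by decide), e15]⟩
  rw [hv, e14, h₉, productCost]
  ring

/-- Store the candidate in the arrays `kx` and `ky`. -/
def store (kx ky km : ℕ) : Prog :=
  .seq (.rset 15 (.const 0) (.const 0) (rvar 14))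
    (.seq (fill ky (entry 12)) (.seq (loadSize km) (fill kx (entry 10))))

theorem store_spec {s : State} {kx ky km m n : ℕ} (hm : s.ints km 0 0 = m)
    (hn : s.ints 2 0 0 = n) (hm1 : 1 ≤ m) (hn1 : 1 ≤ n) (hkm : km < 2)
    (hx : kx = 4 ∨ kx = 5) (hy : ky = 4 ∨ ky = 5) (hxy : kx ≠ ky) :
    Reaches (store kx ky km) s (200 * (m ^ 3 + n ^ 3)) fun s' =>
      SameInput s s' ∧ s'.reals 15 0 0 = s.reals 14 0 0 ∧ s'.matrix kx m = s.matrix 10 m ∧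
        s'.matrix ky n = s.matrix 12 n := by
  have hm2 : m ^ 2 ≤ m ^ 3 := Nat.pow_le_pow_right hm1 (by norm_num)
  have hn2 : n ^ 2 ≤ n ^ 3 := Nat.pow_le_pow_right hn1 (by norm_num)
  have hm0 : 1 ≤ m ^ 2 := Nat.one_le_pow _ _ hm1
  refine (Reaches.seq (T₁ := 10) (T₂ := 100 * n ^ 2 + (10 + 100 * m ^ 2))
    (R := fun s' => s'.ints = s.ints ∧ (∀ k, k ≠ 15 → s'.reals k = s.reals k) ∧
      s'.reals 15 0 0 = s.reals 14 0 0)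
    (Reaches.of_wp (by
      exact ⟨rfl, fun k hk => setCell_of_ne _ _ _ _ hk,
        by simp [setCell, RExp.eval, IExp.eval]⟩) (by decide)) ?_).mono (by omega) fun _ _ h => h
  rintro s₁ - ⟨hi₁, hr₁, hv₁⟩
  refine (fill_spec (s.matrix 12 n) (by rw [hi₁, hn]) hn1 (by simp [RExp.cost, IExp.cost]) ?_).seq
    ?_
  · intro i j s' hf hi hj
    simp [RExp.eval, IExp.eval, hi, hj, State.matrix,
      hf.2 12 (by rw [fill_realWrites, List.mem_singleton]; omega), hr₁ 12]
  intro s₂ hf₂ h₂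
  have K₂ := fill_sameInput hf₂ (by omega)
  refine (loadSize_spec (by rw [K₂.1 km hkm, hi₁, hm])).seq ?_
  rintro s₃ hf₃ ⟨hN₃, hr₃⟩
  refine (fill_spec (s.matrix 10 m) hN₃ hm1 (by simp [RExp.cost, IExp.cost]) ?_).mono le_rfl ?_
  · intro i j s' hf hi hj
    simp [RExp.eval, IExp.eval, hi, hj, State.matrix,
      hf.2 10 (by rw [fill_realWrites, List.mem_singleton]; omega), hr₃,
      hf₂.2 10 (by rw [fill_realWrites, List.mem_singleton]; omega), hr₁ 10]
  intro s₄ hf₄ h₄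
  have K₁ : SameInput s s₁ := ⟨fun k _ => by rw [hi₁], fun k hk => hr₁ k (by omega)⟩
  refine ⟨((K₁.trans K₂).trans (loadSize_sameInput hf₃)).trans (fill_sameInput hf₄ (by omega)), ?_,
    h₄, ?_⟩
  · rw [hf₄.2 15 (by rw [fill_realWrites, List.mem_singleton]; omega), hr₃,
      hf₂.2 15 (by rw [fill_realWrites, List.mem_singleton]; omega), hv₁]
  · rw [State.matrix_congr n (hf₄.2 ky (by
      rw [fill_realWrites, List.mem_singleton]; exact hxy.symm)),
      State.matrix_congr n (congr_fun hr₃ ky), h₂]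

/-! ### Keeping the best candidate -/

/-- Compute a candidate, and store it if it is the first one or better than the stored one. -/
def candidate (first neg : Bool) (ka kb kC kD km kn kx ky : ℕ) : Prog :=
  .seq (compute neg ka kb kC kD km kn)
    (.ite (if first then .req .zero .zero else .rlt (rvar 14) (rvar 15)) (store kx ky km) .skip)

/-- The arrays `kx`, `ky` hold assignments with the value in the variable `15`. -/
def Stored {m n : ℕ} (f : Matrix (Fin m) (Fin m) ℝ → Matrix (Fin n) (Fin n) ℝ → ℝ)
    (kx ky : ℕ) (s : State) : Prop :=
  IsAssignment (s.matrix kx m) ∧ IsAssignment (s.matrix ky n) ∧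
    s.reals 15 0 0 = f (s.matrix kx m) (s.matrix ky n)

theorem compute_realWrites (neg : Bool) (ka kb kC kD km kn : ℕ) :
    (compute neg ka kb kC kD km kn).realWrites = (compute true 0 0 0 0 0 0).realWrites := by
  cases neg <;> rfl

/-- The computed pair appears only existentially because it may be discarded. What later comparisons
need is that the stored value is at most its cost and never increases. -/
theorem candidate_spec {m n : ℕ} {a C : Matrix (Fin m) (Fin m) ℝ}
    {b D : Matrix (Fin n) (Fin n) ℝ} {ka kb kC kD km kn kx ky : ℕ} {s : State} (first neg : Bool)
    (h : Loaded a b C D ka kb kC kD km kn s) (hm1 : 1 ≤ m) (hn1 : 1 ≤ n)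
    (ha : ka < 4) (hb : kb < 4) (hC : kC < 4) (hD : kD < 4) (hm : km < 2) (hn : kn < 2)
    (hx : kx = 4 ∨ kx = 5) (hy : ky = 4 ∨ ky = 5) (hxy : kx ≠ ky)
    (hs : first = true ∨ Stored (productCost a b C D) kx ky s) :
    Reaches (candidate first neg ka kb kC kD km kn kx ky) s (4000 * (m ^ 3 + n ^ 3)) fun s' =>
      SameInput s s' ∧ Stored (productCost a b C D) kx ky s' ∧
      (first = false → s'.reals 15 0 0 ≤ s.reals 15 0 0) ∧
      ∃ x y, IsLAPMin (if neg then -b else b) y ∧ IsLAPMin (linCost b y • a + C) x ∧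
        s'.reals 15 0 0 ≤ productCost a b C D x y := by
  have hm3 : 1 ≤ m ^ 3 := Nat.one_le_pow _ _ hm1
  have hcost : (if first then BExp.req .zero .zero else .rlt (rvar 14) (rvar 15)).cost ≤ 10 := by
    cases first <;> simp [BExp.cost, RExp.cost, IExp.cost]
  refine ((compute_spec neg h hm1 hn1 ha hb hC hD hm hn).seq
    (T₂ := 10 + (200 * (m ^ 3 + n ^ 3) + 1) + 1) ?_).mono (by omega) fun _ _ h => h
  rintro s₁ hf₁ ⟨K₁, hN₁, hY, hX, hv, hb₁⟩
  refine (Reaches.ite (T₁ := 200 * (m ^ 3 + n ^ 3)) (T₂ := 1) (fun hc => ?_) fun hc => ?_).mono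
    (by omega) fun _ _ h => h
  · refine (store_spec (by rw [K₁.1 km hm, h.m_eq]) hN₁ hm1 hn1 hm hx hy hxy).mono le_rfl ?_
    rintro s₂ - ⟨K₂, h15, hx₂, hy₂⟩
    refine ⟨K₁.trans K₂, ⟨by rw [hx₂]; exact hX.1, by rw [hy₂]; exact hY.1,
      by rw [h15, hx₂, hy₂, hv]⟩, fun hf => ?_, _, _, hY, hX, by rw [h15, hv]⟩
    subst hf
    simp only [Bool.false_eq_true, if_false, BExp.Holds, RExp.eval, IExp.eval, hb₁] at hc
    rw [h15]
    exact hc.le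
  · have hf : first = false := by
      cases first
      · rfl
      · simp [BExp.Holds] at hc
    subst hf
    simp only [Bool.false_eq_true, if_false, BExp.Holds, RExp.eval, IExp.eval, hb₁, not_lt] at hc
    have hS : Stored (productCost a b C D) kx ky s := by simpa using hs
    have hw : ∀ k, k = 4 ∨ k = 5 → s₁.reals k = s.reals k := fun k hk => hf₁.2 k (by
      rw [compute_realWrites]
      rcases hk with rfl | rfl <;> decide)
    refine Reaches.of_wp (T := 1) ?_ le_rfl
    refine ⟨K₁, ?_, fun _ => by rw [hb₁], _, _, hY, hX, ?_⟩
    · rw [Stored, State.matrix_congr m (hw kx hx), State.matrix_congr n (hw ky hy), hb₁]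
      exact hS
    · rw [hb₁, ← hv]
      exact hc

/-- A program for the bilinear assignment problem with a factored cost array. -/
def solver : Prog :=
  .seq (candidate true false 0 1 2 3 0 1 4 5)
    (.seq (candidate false true 0 1 2 3 0 1 4 5)
      (.seq (candidate false false 1 0 3 2 1 0 5 4) (candidate false true 1 0 3 2 1 0 5 4)))

theorem inputState_loaded {m n : ℕ} (a : Matrix (Fin m) (Fin m) ℝ) (b : Matrix (Fin n) (Fin n) ℝ)
    (C : Matrix (Fin m) (Fin m) ℝ) (D : Matrix (Fin n) (Fin n) ℝ) :
    Loaded a b C D 0 1 2 3 0 1 (inputState a b C D) := by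
  constructor
  · simp [inputState]
  · simp [inputState]
  all_goals
    funext i j
    simp [State.matrix, inputState, padded]

theorem Stored.swap {m n : ℕ} {a C : Matrix (Fin m) (Fin m) ℝ} {b D : Matrix (Fin n) (Fin n) ℝ}
    {kx ky : ℕ} {s : State} (h : Stored (productCost a b C D) kx ky s) :
    Stored (productCost b a D C) ky kx s :=
  ⟨h.2.1, h.1, by rw [h.2.2, productCost_swap]⟩

/-- The final value is at most that of each of the four candidates. Whichever of `C` and `D` is a
sum matrix, the corresponding two bound the cost of every pair from below. -/
theorem solver_spec {m n : ℕ} (hm : 1 ≤ m) (hn : 1 ≤ n)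
    (a : Matrix (Fin m) (Fin m) ℝ) (b : Matrix (Fin n) (Fin n) ℝ)
    (C : Matrix (Fin m) (Fin m) ℝ) (D : Matrix (Fin n) (Fin n) ℝ)
    (hCD : IsSumMatrix C ∨ IsSumMatrix D) :
    Reaches solver (inputState a b C D) (16000 * (m ^ 3 + n ^ 3)) fun s' =>
      IsAssignment (s'.matrix 4 m) ∧ IsAssignment (s'.matrix 5 n) ∧
        ∀ x y, IsAssignment x → IsAssignment y →
          productCost a b C D (s'.matrix 4 m) (s'.matrix 5 n) ≤ productCost a b C D x y := by
  have L := inputState_loaded a b C D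
  refine ((candidate_spec (kx := 4) (ky := 5) true false L hm hn (by decide) (by decide)
    (by decide) (by decide) (by decide) (by decide) (by decide) (by decide) (by decide)
    (.inl rfl)).seq (T₂ := 4000 * (m ^ 3 + n ^ 3) +
      (4000 * (n ^ 3 + m ^ 3) + 4000 * (n ^ 3 + m ^ 3))) ?_).mono (by omega) fun _ _ h => h
  rintro s₁ - ⟨K₁, S₁, -, x₁, y₁, hy₁, hx₁, hle₁⟩
  have L₁ := L.congr K₁ (by decide) (by decide) (by decide) (by decide) (by decide) (by decide)
  refine (candidate_spec false true L₁ hm hn (by decide) (by decide)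
    (by decide) (by decide) (by decide) (by decide) (by decide) (by decide) (by decide)
    (.inr S₁)).seq ?_
  rintro s₂ - ⟨K₂, S₂, hb₂, x₂, y₂, hy₂, hx₂, hle₂⟩
  have L₂ := L₁.congr K₂ (by decide) (by decide) (by decide) (by decide) (by decide) (by decide)
  refine (candidate_spec false false L₂.swap hn hm (by decide) (by decide)
    (by decide) (by decide) (by decide) (by decide) (by decide) (by decide) (by decide)
    (.inr S₂.swap)).seq ?_
  rintro s₃ - ⟨K₃, S₃, hb₃, y₃, x₃, hx₃, hy₃, hle₃⟩
  have L₃ := L₂.swap.congr K₃ (by decide) (by decide) (by decide) (by decide) (by decide)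
    (by decide)
  refine (candidate_spec false true L₃ hn hm (by decide) (by decide)
    (by decide) (by decide) (by decide) (by decide) (by decide) (by decide) (by decide)
    (.inr S₃)).mono le_rfl ?_
  rintro s₄ - ⟨-, S₄, hb₄, y₄, x₄, hx₄, hy₄, hle₄⟩
  replace hb₂ := hb₂ rfl
  replace hb₃ := hb₃ rfl
  replace hb₄ := hb₄ rfl
  simp only [Bool.false_eq_true, if_false] at hy₁ hx₃
  simp only [if_true] at hy₂ hx₄
  obtain ⟨hA, hB, hv⟩ := S₄.swap
  refine ⟨hA, hB, fun x y hx hy => ?_⟩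
  rw [← hv]
  rcases hCD with hC | hD
  · have := productCost_le_or_le hC hx₃ (isLAPMin_neg.1 hx₄) hy₃ hy₄ hy hx
    rw [productCost_swap a b C D x y] at this
    rcases this with h | h <;> linarith
  · rcases productCost_le_or_le hD hy₁ (isLAPMin_neg.1 hy₂) hx₁ hx₂ hx hy with h | h <;> linarith

end BAP

theorem mainTheorem7 :
    -- one program solves all instances in time `O(m ^ 3 + n ^ 3)`, given the factored form
    (∃ (P : BAP.Prog) (K : ℕ), ∀ m n : ℕ, 1 ≤ m → 1 ≤ n →
      ∀ (Q : Fin m → Fin m → Fin n → Fin n → ℝ)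
        (a : Matrix (Fin m) (Fin m) ℝ) (b : Matrix (Fin n) (Fin n) ℝ)
        (C : Matrix (Fin m) (Fin m) ℝ) (D : Matrix (Fin n) (Fin n) ℝ),
        BAP.IsFactoredForm Q a b → (BAP.IsSumMatrix C ∨ BAP.IsSumMatrix D) →
          ∃ (t : ℕ) (s : BAP.State), BAP.Run P (BAP.inputState a b C D) t s ∧
            t ≤ K * (m ^ 3 + n ^ 3) ∧
            BAP.IsOptimal Q C D (s.matrix 4 m) (s.matrix 5 n)) ∧
    -- the better of two solutions obtained from linear assignment problems is optimal
    (∀ (m n : ℕ) (Q : Fin m → Fin m → Fin n → Fin n → ℝ)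
      (a : Matrix (Fin m) (Fin m) ℝ) (b : Matrix (Fin n) (Fin n) ℝ)
      (C : Matrix (Fin m) (Fin m) ℝ) (D : Matrix (Fin n) (Fin n) ℝ),
      BAP.IsFactoredForm Q a b →
        (BAP.IsSumMatrix D → ∀ (y₁ y₂ : Matrix (Fin n) (Fin n) ℝ) (x₁ x₂ : Matrix (Fin m) (Fin m) ℝ),
          BAP.IsLAPMin b y₁ → BAP.IsLAPMax b y₂ →
          BAP.IsLAPMin (BAP.linCost b y₁ • a + C) x₁ →
          BAP.IsLAPMin (BAP.linCost b y₂ • a + C) x₂ →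
            (BAP.objective Q C D x₁ y₁ ≤ BAP.objective Q C D x₂ y₂ →
              BAP.IsOptimal Q C D x₁ y₁) ∧
            (BAP.objective Q C D x₂ y₂ ≤ BAP.objective Q C D x₁ y₁ →
              BAP.IsOptimal Q C D x₂ y₂)) ∧
        (BAP.IsSumMatrix C → ∀ (x₁ x₂ : Matrix (Fin m) (Fin m) ℝ) (y₁ y₂ : Matrix (Fin n) (Fin n) ℝ),
          BAP.IsLAPMin a x₁ → BAP.IsLAPMax a x₂ →
          BAP.IsLAPMin (BAP.linCost a x₁ • b + D) y₁ →
          BAP.IsLAPMin (BAP.linCost a x₂ • b + D) y₂ →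
            (BAP.objective Q C D x₁ y₁ ≤ BAP.objective Q C D x₂ y₂ →
              BAP.IsOptimal Q C D x₁ y₁) ∧
            (BAP.objective Q C D x₂ y₂ ≤ BAP.objective Q C D x₁ y₁ →
              BAP.IsOptimal Q C D x₂ y₂))) := by
  refine ⟨⟨BAP.solver, 16000, fun m n hm hn Q a b C D hQ hCD => ?_⟩,
    fun m n Q a b C D hQ => ⟨fun hD y₁ y₂ x₁ x₂ hy₁ hy₂ hx₁ hx₂ => ?_,
      fun hC x₁ x₂ y₁ y₂ hx₁ hx₂ hy₁ hy₂ => ?_⟩⟩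
  · obtain ⟨t, s, hr, ht, hx, hy, hopt⟩ := BAP.solver_spec hm hn a b C D hCD
    refine ⟨t, s, hr, ht, hx, hy, fun x' y' hx' hy' => ?_⟩
    rw [BAP.objective_eq_productCost hQ, BAP.objective_eq_productCost hQ]
    exact hopt x' y' hx' hy'
  · simp only [BAP.IsOptimal, BAP.objective_eq_productCost hQ]
    refine ⟨fun h => ⟨hx₁.1, hy₁.1, fun x y hx hy => ?_⟩,
      fun h => ⟨hx₂.1, hy₂.1, fun x y hx hy => ?_⟩⟩ <;>
    rcases BAP.productCost_le_or_le hD hy₁ hy₂ hx₁ hx₂ hx hy with h' | h' <;> linarith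
  -- Writing the objective with the roles of the two matrices exchanged reduces this case to the
  -- same lemma.
  · simp only [BAP.IsOptimal, BAP.objective_eq_productCost hQ, ← BAP.productCost_swap a b C D] at *
    refine ⟨fun h => ⟨hx₁.1, hy₁.1, fun x y hx hy => ?_⟩,
      fun h => ⟨hx₂.1, hy₂.1, fun x y hx hy => ?_⟩⟩ <;>
    rcases BAP.productCost_le_or_le hC hx₁ hx₂ hy₁ hy₂ hy hx with h' | h' <;> linarith
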